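/- **Bellman–Ford.** A *Bellman–Ford instance* is a finite undirected graph $G$ with vertex labels $a_G(v)\ge 0$ and edge weights $w_G(e)\ge 0$. Write $N(v)$ for the closed neighbourhood of $v$ (the neighbours of $v$ together with $v$ itself) and put $w_G(v,v)=0$. The $t$-step Bellman–Ford distance $x_v^{(t)}$ is defined by $x_v^{(0)}=a_G(v)$ and $x_v^{(t)}=\min_{u\in N(v)}\bigl(x_u^{(t-1)}+w_G(u,v)\bigr)$. **Network.** Let $K,m,d\ge 1$ be integers, $J=2mK$, and number the layers $1,\dots,J$ so that step $t\in\{1,\dots,K\}$ consists of the aggregation layers $2m(t-1)+1,\dots,2m(t-1)+m$ followed by the update layers $2m(t-1)+m+1,\dots,2mt$. Let $d_j=1$ if $j=0$, $j=J$, or $j$ is the last aggregation layer $2m(t-1)+m$ of some step $t$, and $d_j=d$ otherwise. Let $j_0=0$ and let $j_k=2m(k-1)+1$ be the first aggregation layer of step $k$, $1\le k\le K$. The parameters $\theta$ are arbitrary real matrices $W^j\in\mathbb R^{d_j\times d_{j-1}}$ and vectors $b^j\in\mathbb R^{d_j}$ ($1\le j\le J$) and vectors $C^k\in\mathbb R^{d_{j_k}}$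 ($1\le k\le K$). On a Bellman–Ford instance $G$ set $h_v^{(0)}=a_G(v)$ and, for $t=1,\dots,K$, $$h_v^{(t)}=\mathrm{UPD}^{(t)}\Bigl(\min_{u\in N(v)}\mathrm{AGG}^{(t)}\bigl(h_u^{(t-1)},w_G(v,u)\bigr)\Bigr),$$ where $\mathrm{AGG}^{(t)}$ and $\mathrm{UPD}^{(t)}$ are the $m$-layer ReLU networks formed by the aggregation and update layers of step $t$: layer $j$ is $y\mapsto\sigma(W^jy+b^j)$ with $\sigma=\max(0,\cdot)$ componentwise, except that the first aggregation layer of step $t$ is $(y,w)\mapsto\sigma(W^{j_t}y+C^tw+b^{j_t})$. In particular the aggregated value is one-dimensional and $h_v^{(K)}\in\mathbb R$. **Loss.** Let $X$ be a finite set of pairs $(G,v)$ with $G$ a Bellman–Ford instance and $v\in V(G)$, let $N=|X|$, and let $\eta$ be a real number. With $\|\cdot\|_1$ the sum of the absolute values of the entries, put $$\mathcal L(\theta)=\frac1N\sum_{(G,v)\in X}\bigl|h_v^{(K)}-x_v^{(K)}\bigr|+\eta\Bigl(\sum_{k=0}^{K}\sum_{j=j_k+1}^{J}\|W^j\|_1+\sum_{k=1}^K\|C^k\|_1+\sum_{j=1}^J\|b^j\|_1\Bigr).$$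 **Training set.** For $z=(z_0,\dots,z_K)$ with nonnegative entries and $\beta>0$, let $P_\beta(z)$ be the path with vertices $v_0,\dots,v_K$ and edges $v_{i-1}v_i$ of weight $z_i$ ($1\le i\le K$), where $v_0$ has label $z_0$ and $v_1,\dots,v_K$ have label $\beta$. For $x\ge 0$ let $T_{S_{x,K}}$ consist of the $K+1$ pairs $(P_\beta(x e_k),v_K)$, $0\le k\le K$, where $e_0,\dots,e_K$ is the standard basis of $\mathbb R^{K+1}$. **Theorem.** Assume that $\eta\ge 2K\exp\bigl(m(K^2+3K)\bigr)$, that $x\ge 4mKN\eta$, that $\beta\ge 2(N+x+1)$, and that $T_{S_{x,K}}\subseteq X$. Let $\varepsilon\le\frac12$ and let $\theta$ be parameters with $\mathcal L(\theta)\le\inf_{\theta'}\mathcal L(\theta')+\varepsilon$. Then for every Bellman–Ford instance $G$ and every vertex $v\in V(G)$, $$\bigl|h_v^{(K)}-x_v^{(K)}\bigr|\le\varepsilon\,\bigl(x_v^{(K)}+1\bigr).$$ -/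

import Mathlib

open scoped NNReal

universe u

namespace BFLearning

/-! ### Bellman-Ford instances and the Bellman-Ford update -/

/-- A Bellman-Ford instance: a finite undirected graph with nonnegative real vertex labels and
nonnegative real edge weights. -/
structure BFInstance : Type (u + 1) where
  /-- the vertices -/
  V : Type u
  [fintypeV : Fintype V]
  /-- the edges -/
  graph : SimpleGraph V
  /-- the vertex labels -/
  label : V → ℝ≥0
  /-- the edge weights -/
  edgeWeight : graph.edgeSet → ℝ≥0

attribute [instance] BFInstance.fintypeV

namespace BFInstance

open scoped Classical in
/-- The closed neighbourhood `N(v) ∪ {v}`. -/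
noncomputable def nbrs (G : BFInstance.{u}) (v : G.V) : Finset G.V :=
  Finset.univ.filter fun u => u = v ∨ G.graph.Adj v u

theorem nbrs_nonempty (G : BFInstance.{u}) (v : G.V) : (G.nbrs v).Nonempty :=
  ⟨v, by simp [nbrs]⟩

open scoped Classical in
/-- The weight `w(u, v)` of a pair of vertices `u ∈ N(v) ∪ {v}`: the weight of the edge `uv`, and
`w(v, v) = 0`. (On all other pairs, where it is never used, the value is `0` as well.) -/
noncomputable def weight (G : BFInstance.{u}) (u v : G.V) : ℝ≥0 :=
  if h : G.graph.Adj u v then G.edgeWeight ⟨s(u, v), h⟩ else 0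

/-- The Bellman-Ford update `Γ`: same graph, same edge weights, and the new label of `v` is
`min {a(u) + w(u, v) : u ∈ N(v) ∪ {v}}`. -/
noncomputable abbrev update (G : BFInstance.{u}) : BFInstance.{u} where
  V := G.V
  graph := G.graph
  label v := (G.nbrs v).inf' (G.nbrs_nonempty v) fun u => G.label u + G.weight u v
  edgeWeight := G.edgeWeight

/-- The label of `v` in the `t`-fold Bellman-Ford update of `G`, i.e. the `t`-step Bellman-Ford
distance `x_v^(t)` of `v`. -/
noncomputable def dist : (t : ℕ) → (G : BFInstance.{u}) → G.V → ℝ≥0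
  | 0, G => G.label
  | t + 1, G => dist t G.update

end BFInstance

/-- The set `V₁(𝒢)` of pairs of a Bellman-Ford instance and one of its vertices. -/
abbrev VertexInstance : Type (u + 1) := Σ G : BFInstance.{u}, G.V

/-! ### The path training set -/

/-- The path `P_β(z)` with vertices `v_0, …, v_K` and edges `v_{i-1} v_i`: the label of `v_0` is
`z_0`, all other labels are `β`, and the edge `v_{i-1} v_i` has weight `z_i`, `i = 1, …, K`.
(For an edge `e`, the larger one of its end points is `e.sup`.) -/
def pathInstance (K : ℕ) (β : ℝ≥0) (z : Fin (K + 1) → ℝ≥0) : BFInstance.{0} where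
  V := Fin (K + 1)
  graph := SimpleGraph.pathGraph (K + 1)
  label i := if i = 0 then z 0 else β
  edgeWeight e := z (e : Sym2 (Fin (K + 1))).sup

/-- The path training set `T_{S_{x,K}}`: the end vertices `v_K` of the `K + 1` paths `P_β(x e_k)`,
where `e_0, …, e_K` are the unit vectors. -/
def pathTrainingSet (K : ℕ) (β x : ℝ≥0) : Set VertexInstance.{0} :=
  Set.range fun k : Fin (K + 1) => ⟨pathInstance K β (Pi.single k x), Fin.last K⟩

/-! ### The architecture

The network has `J = 2 m K` global layers: for each of the `K` message-passing steps there are `m`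
layers of an aggregation FNN followed by `m` layers of an update FNN. -/

/-- The number `2 m t` of global layers that precede message-passing step `t + 1`. The layers of
that step are the aggregation layers `layerStart m t + 1, …, layerStart m t + m` and the update
layers `layerStart m t + m + 1, …, layerStart m t + m + m`. -/
def layerStart (m : ℕ) : ℕ → ℕ
  | 0 => 0
  | t + 1 => layerStart m t + m + m

theorem layerStart_eq (m t : ℕ) : layerStart m t = 2 * m * t := by
  induction t with
  | zero => rfl
  | succ t ih => rw [layerStart, ih]; ring

theorem layerStart_succ_le {m K t : ℕ} (ht : t + 1 ≤ K) :
    layerStart m t + m + m ≤ 2 * m * K := by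
  have h : layerStart m (t + 1) ≤ 2 * m * K := by
    rw [layerStart_eq]; exact Nat.mul_le_mul_left _ ht
  exact h

/-- The dimension `d_j` of the features after global layer `j`: it is `1` for the input `j = 0`, for
the output `j = J` and for the last layer of each aggregation FNN, and the hidden dimension `d`
otherwise. -/
def dim (m K d j : ℕ) : ℕ :=
  if j = 0 ∨ j = 2 * m * K ∨ ∃ t < K, j = layerStart m t + m then 1 else d

theorem dim_layerStart_last (m K d : ℕ) : dim m K d (layerStart m K) = 1 := by
  simp [dim, layerStart_eq]

/-- The parameters: weight matrices `W^1, …, W^J` acting on the vertex features, vectors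
`C^1, …, C^K` acting on the edge weights in the first layer of each aggregation FNN, and bias
vectors `b^1, …, b^J`. All indices are shifted to start at `0`. -/
structure Params (m K d : ℕ) where
  W : (j : Fin (2 * m * K)) → Matrix (Fin (dim m K d (j + 1))) (Fin (dim m K d j)) ℝ
  C : (k : Fin K) → Fin (dim m K d (layerStart m k + 1)) → ℝ
  b : (j : Fin (2 * m * K)) → Fin (dim m K d (j + 1)) → ℝ

/-- The rectified linear unit, applied componentwise. -/
def relu {n : ℕ} (y : Fin n → ℝ) : Fin n → ℝ := fun i => max 0 (y i)

variable {m K d : ℕ}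

/-- The ReLU FNN formed by the `n` global layers `s + 1, …, s + n`, where the vector `e` is added
before the activation in the first of these layers. For `e = 0` this is
`x ↦ σ(W^{s+n} ⋯ σ(W^{s+1} x + b^{s+1}) ⋯ + b^{s+n})`; for an aggregation FNN, whose first layer acts
on the concatenation of the feature `x` and the edge weight `w` by the matrix `(W^{s+1} | C)`, one
takes `e = w C`. -/
def fnn (θ : Params m K d) (s : ℕ) (e : Fin (dim m K d (s + 1)) → ℝ) :
    (n : ℕ) → s + n ≤ 2 * m * K → (Fin (dim m K d s) → ℝ) → Fin (dim m K d (s + n)) → ℝ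
  | 0, _, x => x
  | 1, h, x => relu ((θ.W ⟨s, h⟩).mulVec x + e + θ.b ⟨s, h⟩)
  | n + 2, h, x =>
      relu ((θ.W ⟨s + (n + 1), h⟩).mulVec (fnn θ s e (n + 1) (Nat.le_of_succ_le h) x)
        + θ.b ⟨s + (n + 1), h⟩)

/-- The features `h_v^(t)` of the min-aggregation MPNN: `h_v^(0) = a(v)`, and `h_v^(t+1)` is the
value of the update FNN of step `t + 1` at
`min {AGG(h_u^(t), w(v, u)) : u ∈ N(v) ∪ {v}}` (componentwise minimum), where `AGG` is the
aggregation FNN of step `t + 1`. -/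
noncomputable def feature (θ : Params m K d) (G : BFInstance.{u}) :
    (t : ℕ) → t ≤ K → G.V → Fin (dim m K d (layerStart m t)) → ℝ
  | 0, _, v => fun _ => (G.label v : ℝ)
  | t + 1, ht, v =>
      fnn θ (layerStart m t + m) 0 m (layerStart_succ_le ht) fun i =>
        (G.nbrs v).inf' (G.nbrs_nonempty v) fun u =>
          fnn θ (layerStart m t) ((G.weight v u : ℝ) • θ.C ⟨t, ht⟩) m
            ((Nat.le_add_right _ _).trans (layerStart_succ_le ht))
            (feature θ G t (Nat.le_of_succ_le ht) u) i

/-- The output `h_v^(K)` of the MPNN, a vector of dimension `1`, as a real number. -/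
noncomputable def output (θ : Params m K d) (G : BFInstance.{u}) (v : G.V) : ℝ :=
  feature θ G K le_rfl v ⟨0, by rw [dim_layerStart_last]; exact Nat.one_pos⟩

/-! ### The loss -/

/-- The empirical loss: the mean absolute error on the training set `X`. -/
noncomputable def empLoss (X : Finset VertexInstance.{0}) (θ : Params m K d) : ℝ :=
  (1 / (X.card : ℝ)) * ∑ p ∈ X, |output θ p.1 p.2 - (p.1.dist K p.2 : ℝ)|

/-- The index `j_k` of the first layer of the `k`-th aggregation FNN, `k = 1, …, K`, and
`j_0 = 0`. -/
def edgeLayer (m : ℕ) : ℕ → ℕ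
  | 0 => 0
  | k + 1 => layerStart m k + 1

/-- The regularizer
`∑_{k=0}^K ∑_{j=j_k+1}^J ‖W^j‖₁ + ∑_{k=1}^K ‖C^k‖₁ + ∑_{j=1}^J ‖b^j‖₁`, with entrywise `ℓ¹`-norms. -/
def regLoss (θ : Params m K d) : ℝ :=
  (∑ k ∈ Finset.range (K + 1),
      ∑ j : Fin (2 * m * K) with edgeLayer m k < j.val + 1, ∑ r, ∑ c, |θ.W j r c|)
    + (∑ k, ∑ r, |θ.C k r|) + ∑ j, ∑ r, |θ.b j r|

/-- The loss `ℒ = ℒ^emp + η ℒ^reg`. -/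
noncomputable def loss (X : Finset VertexInstance.{0}) (η : ℝ) (θ : Params m K d) : ℝ :=
  empLoss X θ + η * regLoss θ

end BFLearning

/-! Cut the network at the aggregated values, where features are scalars. Between two cuts there is
no minimum, only a ReLU network in one scalar `y` and, except in the last block, an edge weight `w`.
Discarding negative weights gives an upper bound `α y + γ w` up to a bias error. What was discarded
has total mass at most `A - α` and `Γ - γ`, where `A` and `Γ` are products of entrywise norms, so
`(2α - A) y + (2γ - Γ) w` is a lower bound (`Sandwich.layer`, `BlockCoeffs`). Minima preserve such
bounds, so the output is compared with the Bellman-Ford distance on every graph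
(`output_le_mul_dist`, `mul_dist_le_output_of_pathCoeff`). It remains to show that the total bias
error is small, and that for each `k` both the coefficient `p k` with which the `k`-th path entry
reaches the output (`pathCoeff`) and the product `P k ≥ p k` of the norms it meets are close to `1`.

The regularizer is the sum over `k` of the sums `S k` of exactly the norms whose product is `P k`,
plus the bias norms (`regLoss_eq`). Exact parameters with all these norms equal to `1` show that the
optimal loss is at most `η M`, with `M = m (K² + 3K)` the number of norms counted. On the `k`-th
training path the target is at least `x` and the output at most `p k * x` plus the bias error, so `p
k < 1` costs empirical loss. By the arithmetic-geometric mean inequality, shrinking `S k` below the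
number of its terms saves at most `2mK max 0 (1 - p k)`. Since `x ≥ 4mKNη`, the total saving is at
most half of the empirical loss plus the bias error. The exponential size of `η` makes the bias
error small compared with the cost of the biases. Hence near-minimal loss leaves no room for
deviation (`coeff_bounds`). -/

namespace BFLearning

/-! ### Elementary inequalities for products and sums -/

variable {m K d : ℕ}

/-- With `p`, `P` the products of the remaining factors, `(2a - A)(2p - P) - (2ap - AP) = 2(A - a)(P
- p)`, which is nonnegative. This makes lower-bound coefficients multiply across blocks. -/
theorem two_mul_prod_sub_prod_le {ι : Type*} (s : Finset ι) (a A : ι → ℝ)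
    (h0 : ∀ i ∈ s, 0 ≤ a i) (h1 : ∀ i ∈ s, a i ≤ A i) (h2 : ∀ i ∈ s, 0 ≤ 2 * a i - A i) :
    2 * ∏ i ∈ s, a i - ∏ i ∈ s, A i ≤ ∏ i ∈ s, (2 * a i - A i) := by
  classical
  induction s using Finset.induction_on with
  | empty => norm_num
  | insert i s hi ih =>
    simp only [Finset.mem_insert, forall_eq_or_imp] at h0 h1 h2
    rw [Finset.prod_insert hi, Finset.prod_insert hi, Finset.prod_insert hi]
    have h := mul_le_mul_of_nonneg_left (ih h0.2 h1.2 h2.2) h2.1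
    have h' := mul_nonneg (sub_nonneg.2 h1.1) (sub_nonneg.2 (Finset.prod_le_prod h0.2 h1.2))
    nlinarith

/-- A single factor with `2 a i < A i` would already make twice the product of the `a` at most the
product of the `A`. -/
theorem two_mul_sub_nonneg_of_prod {ι : Type*} (s : Finset ι) (a A : ι → ℝ)
    (h0 : ∀ i ∈ s, 0 ≤ a i) (h1 : ∀ i ∈ s, a i ≤ A i)
    (h : 0 < 2 * ∏ i ∈ s, a i - ∏ i ∈ s, A i) (i : ι) (hi : i ∈ s) : 0 ≤ 2 * a i - A i := by
  classical
  by_contra! hlt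
  rw [← Finset.mul_prod_erase s a hi, ← Finset.mul_prod_erase s A hi] at h
  have hp : ∏ j ∈ s.erase i, a j ≤ ∏ j ∈ s.erase i, A j :=
    Finset.prod_le_prod (fun j hj => h0 j (Finset.mem_of_mem_erase hj))
      fun j hj => h1 j (Finset.mem_of_mem_erase hj)
  have hn : 0 ≤ ∏ j ∈ s.erase i, a j :=
    Finset.prod_nonneg fun j hj => h0 j (Finset.mem_of_mem_erase hj)
  have hA : 0 ≤ A i := (h0 i hi).trans (h1 i hi)
  nlinarith [mul_le_mul_of_nonneg_left hp hA]

/-- Multiply the bounds `a i ≤ exp (a i - 1)`. -/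
theorem prod_le_exp_sum_sub_card {ι : Type*} (s : Finset ι) (a : ι → ℝ) (h0 : ∀ i ∈ s, 0 ≤ a i) :
    ∏ i ∈ s, a i ≤ Real.exp (∑ i ∈ s, a i - s.card) := by
  have h : ∑ i ∈ s, a i - (s.card : ℝ) = ∑ i ∈ s, (a i - 1) := by simp
  rw [h, Real.exp_sum]
  exact Finset.prod_le_prod h0 fun i _ => by linarith [Real.add_one_le_exp (a i - 1)]

/-- Factorwise, `1 + t + t²/2 ≤ exp t` at `t = a i / 2` dominates `a i`. The halved exponent is what
later leaves room for the constant `1/8` in `bias_le_of_regLoss`. -/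
theorem prod_max_one_le_exp {ι : Type*} (s : Finset ι) (a : ι → ℝ) (h0 : ∀ i ∈ s, 0 ≤ a i) :
    ∏ i ∈ s, max 1 (a i) ≤ Real.exp ((∑ i ∈ s, a i) / 2) := by
  rw [Finset.sum_div, Real.exp_sum]
  refine Finset.prod_le_prod (fun i _ => by positivity) fun i hi => max_le ?_ ?_
  · exact Real.one_le_exp (by linarith [h0 i hi])
  · have := Real.quadratic_le_exp_of_nonneg (x := a i / 2) (by linarith [h0 i hi])
    nlinarith [sq_nonneg (a i - 2)]

/-- A linearized form of the inequality between the arithmetic and the geometric mean. -/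
theorem card_sub_sum_le {ι : Type*} (s : Finset ι) (a : ι → ℝ) (h0 : ∀ i ∈ s, 0 ≤ a i) (p : ℝ)
    (hp : p ≤ ∏ i ∈ s, a i) : (s.card : ℝ) - ∑ i ∈ s, a i ≤ s.card * max 0 (1 - p) := by
  rcases s.eq_empty_or_nonempty with rfl | hs
  · simp
  have hc : (1 : ℝ) ≤ s.card := by exact_mod_cast hs.card_pos
  have hc0 : (0 : ℝ) < s.card := by linarith
  have hP : 0 ≤ ∏ i ∈ s, a i := Finset.prod_nonneg h0
  have hS : 0 ≤ ∑ i ∈ s, a i := Finset.sum_nonneg h0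
  -- The geometric mean is the product raised to the power `1 / s.card ≤ 1`, hence at least the
  -- product or at least `1`.
  have key : min 1 (∏ i ∈ s, a i) ≤ (∑ i ∈ s, a i) / s.card := by
    have h := Real.geom_mean_le_arith_mean_weighted s (fun _ => (s.card : ℝ)⁻¹) a
      (fun _ _ => by positivity) (by simp [hc0.ne']) h0
    rw [Real.finsetProd_rpow s a h0, ← Finset.mul_sum] at h
    rw [div_eq_inv_mul]
    refine le_trans ?_ h
    rcases le_total 1 (∏ i ∈ s, a i) with h1 | h1
    · exact (min_le_left _ _).trans (Real.one_le_rpow h1 (by positivity))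
    · exact (min_le_right _ _).trans
        (Real.self_le_rpow_of_le_one hP h1 (inv_le_one_of_one_le₀ hc))
  rw [le_div_iff₀ hc0] at key
  have h2 : 1 - max 0 (1 - p) ≤ min 1 (∏ i ∈ s, a i) :=
    le_min (by linarith [le_max_left 0 (1 - p)]) (by linarith [le_max_right 0 (1 - p)])
  nlinarith

/-! ### Sandwich bounds for ReLU layers -/

/-- The sum of the absolute values of the entries of a matrix. -/
def matNorm {k n : ℕ} (W : Matrix (Fin k) (Fin n) ℝ) : ℝ := ∑ r, ∑ c, |W r c|

/-- The sum of the absolute values of the entries of a vector. -/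
def vecNorm {k : ℕ} (b : Fin k → ℝ) : ℝ := ∑ r, |b r|

theorem matNorm_nonneg {k n : ℕ} (W : Matrix (Fin k) (Fin n) ℝ) : 0 ≤ matNorm W :=
  Finset.sum_nonneg fun _ _ => Finset.sum_nonneg fun _ _ => abs_nonneg _

theorem vecNorm_nonneg {k : ℕ} (b : Fin k → ℝ) : 0 ≤ vecNorm b :=
  Finset.sum_nonneg fun _ _ => abs_nonneg _

theorem sum_abs_le_matNorm {k n : ℕ} (W : Matrix (Fin k) (Fin n) ℝ) (r : Fin k) :
    ∑ c, |W r c| ≤ matNorm W :=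
  Finset.single_le_sum (f := fun r => ∑ c, |W r c|)
    (fun _ _ => Finset.sum_nonneg fun _ _ => abs_nonneg _) (Finset.mem_univ r)

theorem abs_le_vecNorm {k : ℕ} (b : Fin k → ℝ) (r : Fin k) : |b r| ≤ vecNorm b :=
  Finset.single_le_sum (f := fun r => |b r|) (fun _ _ => abs_nonneg _) (Finset.mem_univ r)

/-- The vector `f` is nonnegative and is approximated by the linear form `a y + c w` from above, and
from below with a loss that is controlled by the distance of `a` and `c` to `A` and `Γ`, both up to
the error `B`. -/
def Sandwich {n : ℕ} (a c : Fin n → ℝ) (A Γ B y w : ℝ) (f : Fin n → ℝ) : Prop :=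
  ∀ i, 0 ≤ f i ∧ (2 * a i - A) * y + (2 * c i - Γ) * w - B ≤ f i ∧ f i ≤ a i * y + c i * w + B

theorem Sandwich.mono {n : ℕ} {a c : Fin n → ℝ} {A Γ B B' y w : ℝ} {f : Fin n → ℝ}
    (h : Sandwich a c A Γ B y w f) (hB : B ≤ B') : Sandwich a c A Γ B' y w f :=
  fun i => ⟨(h i).1, by linarith [(h i).2.1], by linarith [(h i).2.2]⟩

theorem Sandwich.congr_gain {n : ℕ} {a c : Fin n → ℝ} {A A' Γ Γ' B y w : ℝ} {f : Fin n → ℝ}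
    (h : Sandwich a c A Γ B y w f) (hA : A' = A) (hΓ : Γ' = Γ) : Sandwich a c A' Γ' B y w f := by
  rwa [hA, hΓ]

theorem sum_posPart_mul_bounds {k n : ℕ} (W : Matrix (Fin k) (Fin n) ℝ) (r : Fin k)
    {a : Fin n → ℝ} {A : ℝ} (h0 : ∀ i, 0 ≤ a i) (h1 : ∀ i, a i ≤ A) (hA : 0 ≤ A) :
    0 ≤ ∑ c, max (W r c) 0 * a c ∧ ∑ c, max (W r c) 0 * a c ≤ matNorm W * A := by
  refine ⟨Finset.sum_nonneg fun i _ => mul_nonneg (le_max_right _ _) (h0 i), ?_⟩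
  refine le_trans ?_ (mul_le_mul_of_nonneg_right (sum_abs_le_matNorm W r) hA)
  rw [Finset.sum_mul]
  exact Finset.sum_le_sum fun i _ => mul_le_mul (max_le (le_abs_self _) (abs_nonneg _)) (h1 i)
    (h0 i) (abs_nonneg _)

/-- Since `f ≥ 0`, dropping the negative entries of `W` gives the upper bound. For the lower bound,
positive entries use the lower bound on `f` and negative ones a crude upper bound; both fit the form
`2 max (W r i) 0 * a i - |W r i| * A`. -/
theorem Sandwich.layer {k n : ℕ} (W : Matrix (Fin k) (Fin n) ℝ) (C b : Fin k → ℝ)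
    {a c : Fin n → ℝ} {A Γ B y w : ℝ} {f : Fin n → ℝ}
    (ha : ∀ i, a i ≤ A) (hc : ∀ i, c i ≤ Γ) (hA : 0 ≤ A) (hΓ : 0 ≤ Γ)
    (ha0 : ∀ i, 0 ≤ a i) (hc0 : ∀ i, 0 ≤ c i) (hB : 0 ≤ B) (hy : 0 ≤ y) (hw : 0 ≤ w)
    (hf : Sandwich a c A Γ B y w f) :
    Sandwich (fun r => ∑ i, max (W r i) 0 * a i) (fun r => ∑ i, max (W r i) 0 * c i + max (C r) 0)
      (matNorm W * A) (matNorm W * Γ + vecNorm C) (matNorm W * B + vecNorm b) y w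
      (relu (W.mulVec f + w • C + b)) := by
  intro r
  have hWr := sum_abs_le_matNorm W r
  have hCr := abs_le_vecNorm C r
  have hbr := abs_le_vecNorm b r
  have hWa := (sum_posPart_mul_bounds W r ha0 ha hA).1
  have hWc := (sum_posPart_mul_bounds W r hc0 hc hΓ).1
  have up : ∑ i, W r i * f i ≤ (∑ i, max (W r i) 0 * a i) * y + (∑ i, max (W r i) 0 * c i) * w
      + (∑ i, |W r i|) * B := by
    rw [Finset.sum_mul, Finset.sum_mul, Finset.sum_mul, ← Finset.sum_add_distrib,
      ← Finset.sum_add_distrib]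
    refine Finset.sum_le_sum fun i _ => ?_
    obtain ⟨f0, -, f2⟩ := hf i
    have e1 : W r i * f i ≤ max (W r i) 0 * f i := mul_le_mul_of_nonneg_right (le_max_left _ _) f0
    have e2 := mul_le_mul_of_nonneg_left f2 (le_max_right (W r i) 0)
    have e3 := mul_le_mul_of_nonneg_right (max_le (le_abs_self (W r i)) (abs_nonneg _)) hB
    linarith
  have low : 2 * (∑ i, max (W r i) 0 * a i) * y - (∑ i, |W r i|) * (A * y)
      + 2 * (∑ i, max (W r i) 0 * c i) * w - (∑ i, |W r i|) * (Γ * w) - (∑ i, |W r i|) * B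
      ≤ ∑ i, W r i * f i := by
    have : 2 * (∑ i, max (W r i) 0 * a i) * y - (∑ i, |W r i|) * (A * y)
        + 2 * (∑ i, max (W r i) 0 * c i) * w - (∑ i, |W r i|) * (Γ * w) - (∑ i, |W r i|) * B
        = ∑ i, (2 * (max (W r i) 0 * a i) * y - |W r i| * (A * y)
        + 2 * (max (W r i) 0 * c i) * w - |W r i| * (Γ * w) - |W r i| * B) := by
      simp only [Finset.sum_sub_distrib, Finset.sum_add_distrib, Finset.sum_mul, Finset.mul_sum]
    rw [this]
    refine Finset.sum_le_sum fun i _ => ?_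
    obtain ⟨f0, f1, f2⟩ := hf i
    have ay := mul_le_mul_of_nonneg_right (ha i) hy
    have cw := mul_le_mul_of_nonneg_right (hc i) hw
    rcases le_total 0 (W r i) with h | h
    · rw [max_eq_left h, abs_of_nonneg h]
      have := mul_le_mul_of_nonneg_left f1 h
      linarith
    · rw [max_eq_right h, abs_of_nonpos h]
      -- Behind a negative entry `a i`, `c i` are replaced by the uniform `A`, `Γ`, because this
      -- entry contributes nothing to the new coefficients.
      have e : f i ≤ A * y + Γ * w + B := by linarith
      have := mul_le_mul_of_nonneg_left e (neg_nonneg.2 h)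
      linarith
  have hval : relu (W.mulVec f + w • C + b) r = max 0 (∑ i, W r i * f i + w * C r + b r) := rfl
  rw [hval]
  have hwC := mul_le_mul_of_nonneg_left (le_max_left (C r) 0) hw
  have hwC0 := mul_nonneg hw (le_max_right (C r) 0)
  have hwC' : 2 * (w * max (C r) 0) - w * vecNorm C ≤ w * C r := by
    have : 2 * max (C r) 0 - vecNorm C ≤ C r := by
      rcases le_total 0 (C r) with h | h
      · rw [max_eq_left h]; linarith [le_abs_self (C r)]
      · rw [max_eq_right h]; linarith [neg_abs_le (C r)]
    nlinarith [mul_le_mul_of_nonneg_left this hw]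
  have m1 := mul_le_mul_of_nonneg_right hWr hB
  have m2 := mul_le_mul_of_nonneg_right hWr (mul_nonneg hA hy)
  have m3 := mul_le_mul_of_nonneg_right hWr (mul_nonneg hΓ hw)
  have m4 := mul_nonneg (matNorm_nonneg W) hB
  have m5 := vecNorm_nonneg b
  have m6 := mul_nonneg hWa hy
  have m7 := mul_nonneg hWc hw
  refine ⟨le_max_left _ _, le_max_of_le_right ?_, max_le ?_ ?_⟩
  · linarith [neg_abs_le (b r)]
  · linarith
  · linarith [le_abs_self (b r)]

/-! ### Bounds for the blocks of the network -/

/-- The norm of the weight matrix of layer `j + 1`. -/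
noncomputable def nW (θ : Params m K d) (j : ℕ) : ℝ :=
  if h : j < 2 * m * K then matNorm (θ.W ⟨j, h⟩) else 0

/-- The norm of the bias vector of layer `j + 1`. -/
noncomputable def nb (θ : Params m K d) (j : ℕ) : ℝ :=
  if h : j < 2 * m * K then vecNorm (θ.b ⟨j, h⟩) else 0

/-- The norm of the edge weight vector of step `k + 1`. -/
noncomputable def nC (θ : Params m K d) (k : ℕ) : ℝ :=
  if h : k < K then vecNorm (θ.C ⟨k, h⟩) else 0

theorem nW_nonneg (θ : Params m K d) (j : ℕ) : 0 ≤ nW θ j := by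
  unfold nW; split_ifs
  exacts [matNorm_nonneg _, le_rfl]

theorem nb_nonneg (θ : Params m K d) (j : ℕ) : 0 ≤ nb θ j := by
  unfold nb; split_ifs
  exacts [vecNorm_nonneg _, le_rfl]

theorem nC_nonneg (θ : Params m K d) (j : ℕ) : 0 ≤ nC θ j := by
  unfold nC; split_ifs
  exacts [vecNorm_nonneg _, le_rfl]

/-- The product of the norms of the weight matrices of the layers `s + 1, …, t`. -/
noncomputable def gain (θ : Params m K d) (s t : ℕ) : ℝ := ∏ j ∈ Finset.Ico s t, nW θ j

/-- A bound for the contribution of the bias vectors of the layers `s + 1, …, t`. -/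
noncomputable def bias (θ : Params m K d) (s t : ℕ) : ℝ :=
  (∏ j ∈ Finset.Ico s t, max 1 (nW θ j)) * ∑ j ∈ Finset.Ico s t, nb θ j

theorem gain_nonneg (θ : Params m K d) (s t : ℕ) : 0 ≤ gain θ s t :=
  Finset.prod_nonneg fun _ _ => nW_nonneg _ _

@[simp] theorem gain_self (θ : Params m K d) (s : ℕ) : gain θ s s = 1 := by simp [gain]

@[simp] theorem bias_self (θ : Params m K d) (s : ℕ) : bias θ s s = 0 := by simp [bias]

theorem gain_succ (θ : Params m K d) {s t : ℕ} (h : s ≤ t) :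
    gain θ s (t + 1) = nW θ t * gain θ s t := by
  rw [gain, Finset.prod_Ico_succ_top h, mul_comm, gain]

theorem gain_mul_gain (θ : Params m K d) {r s t : ℕ} (h : r ≤ s) (h' : s ≤ t) :
    gain θ r s * gain θ s t = gain θ r t :=
  Finset.prod_Ico_consecutive _ h h'

theorem one_le_prod_max (θ : Params m K d) (s : Finset ℕ) : 1 ≤ ∏ j ∈ s, max 1 (nW θ j) := by
  calc (1 : ℝ) = ∏ j ∈ s, 1 := by simp
    _ ≤ _ := Finset.prod_le_prod (fun _ _ => zero_le_one) fun _ _ => le_max_left _ _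

theorem sum_nb_nonneg (θ : Params m K d) (s : Finset ℕ) : 0 ≤ ∑ j ∈ s, nb θ j :=
  Finset.sum_nonneg fun _ _ => nb_nonneg _ _

theorem bias_nonneg (θ : Params m K d) (s t : ℕ) : 0 ≤ bias θ s t :=
  mul_nonneg (zero_le_one.trans (one_le_prod_max _ _)) (sum_nb_nonneg _ _)

theorem gain_le_prod_max (θ : Params m K d) (s t : ℕ) :
    gain θ s t ≤ ∏ j ∈ Finset.Ico s t, max 1 (nW θ j) :=
  Finset.prod_le_prod (fun _ _ => nW_nonneg _ _) fun _ _ => le_max_right _ _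

/-- Earlier errors are amplified by at most the later gain. The `max 1` in `bias` lets the longer
product dominate the later errors too. -/
theorem mul_bias_add_bias_le (θ : Params m K d) {r s t : ℕ} (h : r ≤ s) (h' : s ≤ t) {a : ℝ}
    (ha : a ≤ gain θ s t) : a * bias θ r s + bias θ s t ≤ bias θ r t := by
  have h1 := one_le_prod_max θ (Finset.Ico r s)
  have h2 := one_le_prod_max θ (Finset.Ico s t)
  have h3 := ha.trans (gain_le_prod_max θ s t)
  have h4 := sum_nb_nonneg θ (Finset.Ico r s)
  have h5 := sum_nb_nonneg θ (Finset.Ico s t)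
  have h6 := mul_le_mul_of_nonneg_right h3 (bias_nonneg θ r s)
  unfold bias at *
  rw [← Finset.prod_Ico_consecutive _ h h', ← Finset.sum_Ico_consecutive _ h h']
  have h7 := mul_le_mul_of_nonneg_right h1 (mul_nonneg (zero_le_one.trans h2) h5)
  linarith

theorem nW_mul_bias_add_nb_le (θ : Params m K d) {s t : ℕ} (h : s ≤ t) :
    nW θ t * bias θ s t + nb θ t ≤ bias θ s (t + 1) := by
  have h1 := mul_bias_add_bias_le θ h (Nat.le_succ t) (a := nW θ t) (by simp [gain])
  have h2 : nb θ t ≤ bias θ t (t + 1) := by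
    have := le_max_left 1 (nW θ t)
    have := nb_nonneg θ t
    simp only [bias, Nat.Ico_succ_singleton, Finset.prod_singleton, Finset.sum_singleton]
    nlinarith
  linarith

/-- The coefficients are chosen before `y`, `w` and `f`, so one choice serves all graphs. Errors are
counted from `s₀`, so networks can be chained. The edge vector bypasses the first matrix, so its
gain starts at `s + 1`. -/
theorem exists_sandwich_fnn (θ : Params m K d) (s s₀ : ℕ) (hs : s₀ ≤ s)
    (C : Fin (dim m K d (s + 1)) → ℝ) (a : Fin (dim m K d s) → ℝ) (A : ℝ) (hA : 0 ≤ A)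
    (ha : ∀ i, 0 ≤ a i ∧ a i ≤ A) (n : ℕ) (h : s + (n + 1) ≤ 2 * m * K) :
    ∃ a' c' : Fin (dim m K d (s + (n + 1))) → ℝ,
      (∀ i, 0 ≤ a' i ∧ a' i ≤ A * gain θ s (s + (n + 1))) ∧
      (∀ i, 0 ≤ c' i ∧ c' i ≤ vecNorm C * gain θ (s + 1) (s + (n + 1))) ∧
      ∀ y w : ℝ, 0 ≤ y → 0 ≤ w → ∀ f, Sandwich a (fun _ => 0) A 0 (bias θ s₀ s) y w f →
        Sandwich a' c' (A * gain θ s (s + (n + 1))) (vecNorm C * gain θ (s + 1) (s + (n + 1)))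
          (bias θ s₀ (s + (n + 1))) y w (fnn θ s (w • C) (n + 1) h f) := by
  induction n with
  | zero =>
    have hW : nW θ s = matNorm (θ.W ⟨s, h⟩) := dif_pos h
    have hb : nb θ s = vecNorm (θ.b ⟨s, h⟩) := dif_pos h
    have hg : gain θ s (s + (0 + 1)) = nW θ s := by
      rw [zero_add, gain_succ θ le_rfl, gain_self, mul_one]
    have hg' : gain θ (s + 1) (s + (0 + 1)) = 1 := gain_self _ _
    refine ⟨_, _, fun i => ?_, fun i => ?_, fun y w hy hw f hf =>
      ((hf.layer (θ.W ⟨s, h⟩) C (θ.b ⟨s, h⟩) (fun i => (ha i).2) (fun i => le_rfl) hA le_rfl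
        (fun i => (ha i).1) (fun i => le_rfl) (bias_nonneg _ _ _) hy hw).mono
        (B' := bias θ s₀ (s + (0 + 1))) ?_).congr_gain ?_ ?_⟩
    · have := sum_posPart_mul_bounds (θ.W ⟨s, h⟩) i (fun i => (ha i).1) (fun i => (ha i).2) hA
      exact ⟨this.1, this.2.trans_eq (by rw [hg, hW, mul_comm])⟩
    · rw [hg', mul_one]
      simp only [mul_zero, Finset.sum_const_zero, zero_add]
      exact ⟨le_max_right _ _,
        max_le ((le_abs_self _).trans (abs_le_vecNorm C i)) (vecNorm_nonneg C)⟩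
    · rw [← hW, ← hb]
      exact nW_mul_bias_add_nb_le θ hs
    · rw [hg, hW, mul_comm]
    · rw [hg']; ring
  | succ n ih =>
    obtain ⟨a₁, c₁, ha₁, hc₁, hf₁⟩ := ih (Nat.le_of_succ_le h)
    have hW : nW θ (s + (n + 1)) = matNorm (θ.W ⟨s + (n + 1), h⟩) := dif_pos h
    have hb : nb θ (s + (n + 1)) = vecNorm (θ.b ⟨s + (n + 1), h⟩) := dif_pos h
    have hg : gain θ s (s + (n + 1 + 1)) = nW θ (s + (n + 1)) * gain θ s (s + (n + 1)) :=
      gain_succ θ (Nat.le_add_right s (n + 1))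
    have hg' : gain θ (s + 1) (s + (n + 1 + 1))
        = nW θ (s + (n + 1)) * gain θ (s + 1) (s + (n + 1)) :=
      gain_succ θ (Nat.add_le_add_left (Nat.succ_pos n) s)
    have hA₁ : 0 ≤ A * gain θ s (s + (n + 1)) := mul_nonneg hA (gain_nonneg _ _ _)
    have hΓ₁ : 0 ≤ vecNorm C * gain θ (s + 1) (s + (n + 1)) :=
      mul_nonneg (vecNorm_nonneg C) (gain_nonneg _ _ _)
    have hrec : ∀ (w : ℝ) f, fnn θ s (w • C) (n + 1 + 1) h f
        = relu ((θ.W ⟨s + (n + 1), h⟩).mulVec (fnn θ s (w • C) (n + 1) (Nat.le_of_succ_le h) f)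
          + w • (0 : Fin (dim m K d (s + (n + 1) + 1)) → ℝ) + θ.b ⟨s + (n + 1), h⟩) := by
      intro w f
      rw [smul_zero, add_zero]
      rfl
    refine ⟨_, _, fun i => ?_, fun i => ?_, fun y w hy hw f hf => hrec w f ▸
      (((hf₁ y w hy hw f hf).layer (θ.W ⟨s + (n + 1), h⟩) 0 (θ.b ⟨s + (n + 1), h⟩)
        (fun i => (ha₁ i).2) (fun i => (hc₁ i).2) hA₁ hΓ₁ (fun i => (ha₁ i).1)
        (fun i => (hc₁ i).1) (bias_nonneg _ _ _) hy hw).mono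
        (B' := bias θ s₀ (s + (n + 1 + 1))) ?_).congr_gain ?_ ?_⟩
    · have := sum_posPart_mul_bounds (θ.W ⟨s + (n + 1), h⟩) i (fun i => (ha₁ i).1)
        (fun i => (ha₁ i).2) hA₁
      exact ⟨this.1, this.2.trans_eq (by rw [hg, hW]; ring)⟩
    · have := sum_posPart_mul_bounds (θ.W ⟨s + (n + 1), h⟩) i (fun i => (hc₁ i).1)
        (fun i => (hc₁ i).2) hΓ₁
      simp only [Pi.zero_apply, max_self, add_zero]
      exact ⟨this.1, this.2.trans_eq (by rw [hg', hW]; ring)⟩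
    · rw [← hW, ← hb]
      exact nW_mul_bias_add_nb_le θ (hs.trans (Nat.le_add_right s (n + 1)))
    · rw [hg, hW]; ring
    · rw [hg', hW]; simp [vecNorm]; ring

/-- The layer at which the `t`-th block starts: block `0` consists of the first aggregation FNN,
block `t` of the `t`-th update FNN and the aggregation FNN after it, and block `K` of the last
update FNN. -/
def blockStart (m K : ℕ) : ℕ → ℕ
  | 0 => 0
  | t + 1 => min (layerStart m t + m) (2 * m * K)

theorem blockStart_succ {t : ℕ} (ht : t < K) : blockStart m K (t + 1) = layerStart m t + m :=
  min_eq_left ((Nat.le_add_right _ _).trans (layerStart_succ_le ht))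

theorem blockStart_last : blockStart m K (K + 1) = 2 * m * K :=
  min_eq_right (by rw [layerStart_eq]; omega)

theorem blockStart_le_layerStart {t : ℕ} (ht : t ≤ K) : blockStart m K t ≤ layerStart m t := by
  cases t with
  | zero => exact le_rfl
  | succ t => rw [blockStart_succ ht]; exact Nat.le_add_right _ _

theorem layerStart_le_blockStart_succ {t : ℕ} (ht : t ≤ K) :
    layerStart m t ≤ blockStart m K (t + 1) := by
  rcases ht.lt_or_eq with h | rfl
  · rw [blockStart_succ h]; exact Nat.le_add_right _ _
  · rw [blockStart_last, layerStart_eq]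

theorem blockStart_le_succ {t : ℕ} (ht : t ≤ K) : blockStart m K t ≤ blockStart m K (t + 1) :=
  (blockStart_le_layerStart ht).trans (layerStart_le_blockStart_succ ht)

/-- The update FNN of step `t` as a function of the aggregated value. For `t = 0` this is the
identity. -/
def pre (θ : Params m K d) : (t : ℕ) → t ≤ K → ℝ → Fin (dim m K d (layerStart m t)) → ℝ
  | 0, _, y => fun _ => y
  | t + 1, ht, y => fnn θ (layerStart m t + m) 0 m (layerStart_succ_le ht) fun _ => y

theorem exists_sandwich_pre (hm : 1 ≤ m) (θ : Params m K d) (t : ℕ) (ht : t ≤ K) :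
    ∃ a : Fin (dim m K d (layerStart m t)) → ℝ,
      (∀ i, 0 ≤ a i ∧ a i ≤ gain θ (blockStart m K t) (layerStart m t)) ∧
      ∀ y w : ℝ, 0 ≤ y → 0 ≤ w →
        Sandwich a (fun _ => 0) (gain θ (blockStart m K t) (layerStart m t)) 0
          (bias θ (blockStart m K t) (layerStart m t)) y w (pre θ t ht y) := by
  cases t with
  | zero =>
    simp only [blockStart, layerStart, gain_self, bias_self]
    refine ⟨fun _ => 1, fun i => ⟨zero_le_one, le_rfl⟩, fun y w hy hw i => ?_⟩
    simp only [pre]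
    refine ⟨hy, ?_, ?_⟩ <;> linarith
  | succ t =>
    obtain ⟨n, rfl⟩ : ∃ n, m = n + 1 := ⟨m - 1, by omega⟩
    obtain ⟨a, c, ha, hc, h⟩ := exists_sandwich_fnn θ (layerStart (n + 1) t + (n + 1))
      (layerStart (n + 1) t + (n + 1)) le_rfl 0 (fun _ => 1) 1 zero_le_one
      (fun _ => ⟨zero_le_one, le_rfl⟩) n (layerStart_succ_le ht)
    have hv : vecNorm (0 : Fin (dim (n + 1) K d (layerStart (n + 1) t + (n + 1) + 1)) → ℝ) = 0 := by
      simp [vecNorm]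
    rw [hv] at h hc
    simp only [one_mul, zero_mul, smul_zero, bias_self] at ha hc h
    -- An update network sees no edge weight: a zero edge vector squeezes its coefficient between
    -- `0` and `0`.
    obtain rfl : c = fun _ => 0 := funext fun i => le_antisymm (hc i).2 (hc i).1
    rw [blockStart_succ ht]
    refine ⟨a, ha, fun y w hy hw => h y w hy hw _ fun i => ?_⟩
    refine ⟨hy, ?_, ?_⟩ <;> linarith

theorem dim_aggregated {t : ℕ} (ht : t < K) : dim m K d (layerStart m t + m) = 1 :=
  if_pos (Or.inr (Or.inr ⟨t, ht, rfl⟩))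

/-- The numbers `α t` and `γ t` are the coefficients of the aggregated value and of the edge weight
in linear approximations of the blocks of the network. -/
structure BlockCoeffs (θ : Params m K d) (α γ : ℕ → ℝ) : Prop where
  nonneg : ∀ t ≤ K, 0 ≤ α t
  le_gain : ∀ t ≤ K, α t ≤ gain θ (blockStart m K t) (blockStart m K (t + 1))
  nonneg_edge : ∀ t < K, 0 ≤ γ t
  le_gain_edge : ∀ t < K, γ t ≤ nC θ t * gain θ (layerStart m t + 1) (blockStart m K (t + 1))
  agg : ∀ t, ∀ ht : t < K, ∀ y w : ℝ, 0 ≤ y → 0 ≤ w →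
    Sandwich (fun _ => α t) (fun _ => γ t)
      (gain θ (blockStart m K t) (blockStart m K (t + 1)))
      (nC θ t * gain θ (layerStart m t + 1) (blockStart m K (t + 1)))
      (bias θ (blockStart m K t) (blockStart m K (t + 1))) y w
      (fnn θ (layerStart m t) (w • θ.C ⟨t, ht⟩) m
        ((Nat.le_add_right _ _).trans (layerStart_succ_le ht)) (pre θ t ht.le y))
  last : ∀ y : ℝ, 0 ≤ y →
    Sandwich (fun _ => α K) (fun _ => 0)
      (gain θ (blockStart m K K) (blockStart m K (K + 1))) 0
      (bias θ (blockStart m K K) (blockStart m K (K + 1))) y 0 (pre θ K le_rfl y)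

/-- Chains the update network of step `t` with the next aggregation network. The target is
one-dimensional, so the coefficient vectors reduce to scalars. -/
theorem exists_agg (hm : 1 ≤ m) (θ : Params m K d) {t : ℕ} (ht : t < K) :
    ∃ α γ : ℝ, (0 ≤ α ∧ α ≤ gain θ (blockStart m K t) (blockStart m K (t + 1))) ∧
      (0 ≤ γ ∧ γ ≤ nC θ t * gain θ (layerStart m t + 1) (blockStart m K (t + 1))) ∧
      ∀ y w : ℝ, 0 ≤ y → 0 ≤ w →
        Sandwich (fun _ => α) (fun _ => γ)
          (gain θ (blockStart m K t) (blockStart m K (t + 1)))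
          (nC θ t * gain θ (layerStart m t + 1) (blockStart m K (t + 1)))
          (bias θ (blockStart m K t) (blockStart m K (t + 1))) y w
          (fnn θ (layerStart m t) (w • θ.C ⟨t, ht⟩) m
            ((Nat.le_add_right _ _).trans (layerStart_succ_le ht)) (pre θ t ht.le y)) := by
  obtain ⟨a, ha, h⟩ := exists_sandwich_pre hm θ t ht.le
  obtain ⟨n, rfl⟩ : ∃ n, m = n + 1 := ⟨m - 1, by omega⟩
  obtain ⟨a', c', ha', hc', h'⟩ := exists_sandwich_fnn θ (layerStart (n + 1) t)
    (blockStart (n + 1) K t) (blockStart_le_layerStart ht.le) (θ.C ⟨t, ht⟩) a _ (gain_nonneg _ _ _)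
    ha n ((Nat.le_add_right _ _).trans (layerStart_succ_le ht))
  have hC : nC θ t = vecNorm (θ.C ⟨t, ht⟩) := dif_pos ht
  have hd : dim (n + 1) K d (layerStart (n + 1) t + (n + 1)) = 1 := dim_aggregated ht
  rw [gain_mul_gain θ (blockStart_le_layerStart ht.le) (Nat.le_add_right _ _)] at ha' h'
  rw [← hC] at hc' h'
  rw [blockStart_succ ht]
  have hi : ∀ i j : Fin (dim (n + 1) K d (layerStart (n + 1) t + (n + 1))), i = j := by
    rw [hd]; exact fun i j => Subsingleton.elim i j
  let i₀ : Fin (dim (n + 1) K d (layerStart (n + 1) t + (n + 1))) := ⟨0, by rw [hd]; exact one_pos⟩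
  refine ⟨a' i₀, c' i₀, ha' i₀, hc' i₀, fun y w hy hw i => ?_⟩
  rw [hi i i₀]
  exact h' y w hy hw _ (h y w hy hw) i₀

theorem exists_blockCoeffs (hm : 1 ≤ m) (θ : Params m K d) : ∃ α γ : ℕ → ℝ, BlockCoeffs θ α γ := by
  obtain ⟨a, ha, h⟩ := exists_sandwich_pre hm θ K le_rfl
  let i₀ : Fin (dim m K d (layerStart m K)) := ⟨0, by rw [dim_layerStart_last]; exact one_pos⟩
  have hi : ∀ i j : Fin (dim m K d (layerStart m K)), i = j := by
    rw [dim_layerStart_last]; exact fun i j => Subsingleton.elim i j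
  have hK : layerStart m K = blockStart m K (K + 1) := by rw [layerStart_eq, blockStart_last]
  have hg : gain θ (blockStart m K K) (layerStart m K)
      = gain θ (blockStart m K K) (blockStart m K (K + 1)) := by rw [hK]
  have hb : bias θ (blockStart m K K) (layerStart m K)
      = bias θ (blockStart m K K) (blockStart m K (K + 1)) := by rw [hK]
  rw [hg] at ha h
  rw [hb] at h
  choose! α γ hα hγ hs using fun (t : ℕ) (ht : t < K) => exists_agg hm θ ht
  refine ⟨fun t => if t < K then α t else a i₀, γ, fun t ht => ?_, fun t ht => ?_,
    fun t ht => (hγ t ht).1, fun t ht => (hγ t ht).2, fun t ht y w hy hw => ?_, fun y hy i => ?_⟩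
  · split_ifs with h'
    exacts [(hα t h').1, (ha i₀).1]
  · split_ifs with h'
    · exact (hα t h').2
    · rw [le_antisymm ht (not_lt.1 h')]
      exact (ha i₀).2
  · simp only [if_pos ht]
    exact hs t ht y w hy hw
  · simp only [lt_irrefl, if_false]
    rw [hi i i₀]
    exact h y 0 hy le_rfl i₀

/-! ### Bellman-Ford distances -/

namespace BFInstance

theorem mem_nbrs (G : BFInstance.{u}) {v w : G.V} : w ∈ G.nbrs v ↔ w = v ∨ G.graph.Adj v w := by
  simp [nbrs]

theorem weight_comm (G : BFInstance.{u}) (v w : G.V) : G.weight v w = G.weight w v := by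
  unfold weight
  by_cases h : G.graph.Adj v w
  · rw [dif_pos h, dif_pos h.symm]
    congr 2
    exact Sym2.eq_swap
  · rw [dif_neg h, dif_neg fun h' => h h'.symm]

theorem dist_succ (t : ℕ) (G : BFInstance.{u}) (v : G.V) :
    dist (t + 1) G v
      = (G.nbrs v).inf' (G.nbrs_nonempty v) fun u => dist t G u + G.weight u v := by
  induction t generalizing G with
  | zero => rfl
  | succ t ih => exact ih G.update v

theorem dist_succ_le (t : ℕ) (G : BFInstance.{u}) {u v : G.V} (hu : u ∈ G.nbrs v) :
    dist (t + 1) G v ≤ dist t G u + G.weight u v := by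
  rw [dist_succ]
  exact Finset.inf'_le (fun u => dist t G u + G.weight u v) hu

theorem exists_dist_succ_eq (t : ℕ) (G : BFInstance.{u}) (v : G.V) :
    ∃ u ∈ G.nbrs v, dist (t + 1) G v = dist t G u + G.weight u v := by
  rw [dist_succ]
  exact Finset.exists_mem_eq_inf' _ _

/-- Following minimizers backwards gives an optimal walk; it may pause at a vertex at cost `0`. -/
theorem exists_walk (G : BFInstance.{u}) (t : ℕ) (v : G.V) :
    ∃ u : ℕ → G.V, u t = v ∧ (∀ s < t, u s ∈ G.nbrs (u (s + 1))) ∧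
      (dist t G v : ℝ) = G.label (u 0) + ∑ s ∈ Finset.range t, (G.weight (u (s + 1)) (u s) : ℝ) := by
  induction t generalizing v with
  | zero => exact ⟨fun _ => v, rfl, fun s hs => absurd hs (Nat.not_lt_zero s), by simp [dist]⟩
  | succ t ih =>
    obtain ⟨w, hw, hd⟩ := exists_dist_succ_eq t G v
    obtain ⟨u, ht, hu, he⟩ := ih w
    have hne : ∀ s ≤ t, Function.update u (t + 1) v s = u s := fun s hs =>
      Function.update_of_ne (by omega) _ _
    refine ⟨Function.update u (t + 1) v, by simp, fun s hs => ?_, ?_⟩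
    · rcases (Nat.lt_succ_iff.1 hs).lt_or_eq with h | rfl
      · rw [hne s h.le, hne (s + 1) h]; exact hu s h
      · rw [hne s le_rfl, Function.update_self, ht]; exact hw
    · rw [hd, NNReal.coe_add, he, Finset.sum_range_succ, hne 0 (Nat.zero_le t), hne t le_rfl,
        Function.update_self, ht, G.weight_comm v w, ← add_assoc]
      congr 2
      refine Finset.sum_congr rfl fun s hs => ?_
      have hs := Finset.mem_range.1 hs
      rw [hne s hs.le, hne (s + 1) hs]

end BFInstance

/-! ### Bounds for the output of the network -/

/-- The aggregated value at the vertex `v` in step `t`, and the label of `v` for `t = 0`. -/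
noncomputable def aggVal (θ : Params m K d) (G : BFInstance.{u}) : ℕ → G.V → ℝ
  | 0, v => G.label v
  | t + 1, v =>
      if ht : t < K then
        (G.nbrs v).inf' (G.nbrs_nonempty v) fun u =>
          fnn θ (layerStart m t) ((G.weight v u : ℝ) • θ.C ⟨t, ht⟩) m
            ((Nat.le_add_right _ _).trans (layerStart_succ_le ht)) (feature θ G t ht.le u)
            ⟨0, by rw [dim_aggregated ht]; exact one_pos⟩
      else 0

theorem feature_eq_pre (θ : Params m K d) (G : BFInstance.{u}) (t : ℕ) (ht : t ≤ K) (v : G.V) :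
    feature θ G t ht v = pre θ t ht (aggVal θ G t v) := by
  cases t with
  | zero => rfl
  | succ t =>
    have hi : ∀ i j : Fin (dim m K d (layerStart m t + m)), i = j := by
      rw [dim_aggregated ht]; exact fun i j => Subsingleton.elim i j
    rw [feature, pre]
    congr 1
    funext i
    rw [aggVal, dif_pos (show t < K from ht)]
    rw [hi i ⟨0, by rw [dim_aggregated ht]; exact one_pos⟩]

theorem aggVal_succ (θ : Params m K d) (G : BFInstance.{u}) {t : ℕ} (ht : t < K) (v : G.V) :
    aggVal θ G (t + 1) v = (G.nbrs v).inf' (G.nbrs_nonempty v) fun u =>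
      fnn θ (layerStart m t) ((G.weight v u : ℝ) • θ.C ⟨t, ht⟩) m
        ((Nat.le_add_right _ _).trans (layerStart_succ_le ht)) (pre θ t ht.le (aggVal θ G t u))
        ⟨0, by rw [dim_aggregated ht]; exact one_pos⟩ := by
  rw [aggVal, dif_pos ht]
  simp only [feature_eq_pre]

theorem BlockCoeffs.aggVal_nonneg {θ : Params m K d} {α γ : ℕ → ℝ} (h : BlockCoeffs θ α γ)
    (G : BFInstance.{u}) (t : ℕ) (ht : t ≤ K) (v : G.V) : 0 ≤ aggVal θ G t v := by
  induction t generalizing v with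
  | zero => exact NNReal.coe_nonneg _
  | succ t ih =>
    rw [aggVal_succ θ G ht]
    exact Finset.le_inf' _ _ fun u _ => (h.agg t ht _ _ (ih (Nat.le_of_succ_le ht) u)
      (NNReal.coe_nonneg _) _).1

theorem BlockCoeffs.aggVal_succ_le {θ : Params m K d} {α γ : ℕ → ℝ} (h : BlockCoeffs θ α γ)
    (G : BFInstance.{u}) {t : ℕ} (ht : t < K) {u v : G.V} (hu : u ∈ G.nbrs v) :
    aggVal θ G (t + 1) v ≤ α t * aggVal θ G t u + γ t * G.weight v u
      + bias θ (blockStart m K t) (blockStart m K (t + 1)) := by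
  rw [aggVal_succ θ G ht]
  exact (Finset.inf'_le _ hu).trans
    (h.agg t ht _ _ (h.aggVal_nonneg G t ht.le u) (NNReal.coe_nonneg _) _).2.2

theorem BlockCoeffs.exists_le_aggVal_succ {θ : Params m K d} {α γ : ℕ → ℝ} (h : BlockCoeffs θ α γ)
    (G : BFInstance.{u}) {t : ℕ} (ht : t < K) (v : G.V) :
    ∃ u ∈ G.nbrs v,
      (2 * α t - gain θ (blockStart m K t) (blockStart m K (t + 1))) * aggVal θ G t u
      + (2 * γ t - nC θ t * gain θ (layerStart m t + 1) (blockStart m K (t + 1))) * G.weight v u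
      - bias θ (blockStart m K t) (blockStart m K (t + 1)) ≤ aggVal θ G (t + 1) v := by
  rw [aggVal_succ θ G ht]
  obtain ⟨u, hu, he⟩ := Finset.exists_mem_eq_inf' (G.nbrs_nonempty v) fun u =>
    fnn θ (layerStart m t) ((G.weight v u : ℝ) • θ.C ⟨t, ht⟩) m
      ((Nat.le_add_right _ _).trans (layerStart_succ_le ht)) (pre θ t ht.le (aggVal θ G t u))
      ⟨0, by rw [dim_aggregated ht]; exact one_pos⟩
  refine ⟨u, hu, ?_⟩
  rw [he]
  exact (h.agg t ht _ _ (h.aggVal_nonneg G t ht.le u) (NNReal.coe_nonneg _) _).2.1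

/-- The product of the coefficients of the blocks `t, …, K`. -/
noncomputable def rem (K : ℕ) (α : ℕ → ℝ) (t : ℕ) : ℝ := ∏ s ∈ Finset.Ico t (K + 1), α s

theorem rem_eq_mul {α : ℕ → ℝ} {t : ℕ} (ht : t ≤ K) : rem K α t = α t * rem K α (t + 1) :=
  Finset.prod_eq_prod_Ico_succ_bot (Nat.lt_succ_of_le ht) _

@[simp] theorem rem_last (α : ℕ → ℝ) : rem K α (K + 1) = 1 := by simp [rem]

theorem rem_nonneg {α : ℕ → ℝ} (h : ∀ t ≤ K, 0 ≤ α t) (t : ℕ) : 0 ≤ rem K α t :=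
  Finset.prod_nonneg fun _ hs => h _ (Nat.lt_succ_iff.1 (Finset.mem_Ico.1 hs).2)

theorem output_eq_pre (θ : Params m K d) (G : BFInstance.{u}) (v : G.V) :
    output θ G v
      = pre θ K le_rfl (aggVal θ G K v) ⟨0, by rw [dim_layerStart_last]; exact one_pos⟩ := by
  rw [output, feature_eq_pre]

/-- Each minimum is at most its value at the neighbour prescribed by the walk, so the block bounds
compose. Multiplying by `rem K α t` normalizes the induction. -/
theorem BlockCoeffs.output_le_walk {θ : Params m K d} {α γ : ℕ → ℝ} (h : BlockCoeffs θ α γ)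
    (G : BFInstance.{u}) (u : ℕ → G.V) (hu : ∀ t < K, u t ∈ G.nbrs (u (t + 1))) :
    output θ G (u K) ≤ rem K α 0 * G.label (u 0)
      + ∑ s ∈ Finset.range K, γ s * rem K α (s + 1) * G.weight (u (s + 1)) (u s)
      + bias θ 0 (2 * m * K) := by
  have key : ∀ t ≤ K, rem K α t * aggVal θ G t (u t) ≤ rem K α 0 * G.label (u 0)
      + ∑ s ∈ Finset.range t, γ s * rem K α (s + 1) * G.weight (u (s + 1)) (u s)
      + rem K α t * bias θ 0 (blockStart m K t) := by
    intro t ht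
    induction t with
    | zero => simp [aggVal, blockStart]
    | succ t ih =>
      have h1 := ih (Nat.le_of_succ_le ht)
      have h2 := mul_le_mul_of_nonneg_left (h.aggVal_succ_le G ht (hu t ht))
        (rem_nonneg h.nonneg (t + 1))
      have h3 := mul_le_mul_of_nonneg_left (mul_bias_add_bias_le θ (Nat.zero_le _)
        (blockStart_le_succ (m := m) (Nat.le_of_succ_le ht)) (h.le_gain t (Nat.le_of_succ_le ht)))
        (rem_nonneg h.nonneg (t + 1))
      rw [rem_eq_mul (Nat.le_of_succ_le ht)] at h1
      rw [Finset.sum_range_succ]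
      linarith
  have h1 := key K le_rfl
  have h2 := (h.last _ (h.aggVal_nonneg G K le_rfl (u K))
    ⟨0, by rw [dim_layerStart_last]; exact one_pos⟩).2.2
  have h3 := mul_bias_add_bias_le θ (Nat.zero_le _) (blockStart_le_succ (m := m) le_rfl)
    (h.le_gain K le_rfl)
  rw [rem_eq_mul le_rfl, rem_last, mul_one] at h1
  rw [output_eq_pre]
  rw [blockStart_last] at h2 h3
  linarith

theorem BlockCoeffs.output_le_mul_dist {θ : Params m K d} {α γ : ℕ → ℝ} (h : BlockCoeffs θ α γ)
    {p : ℝ} (h0 : rem K α 0 ≤ p) (h1 : ∀ t < K, γ t * rem K α (t + 1) ≤ p)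
    (G : BFInstance.{u}) (v : G.V) :
    output θ G v ≤ p * G.dist K v + bias θ 0 (2 * m * K) := by
  obtain ⟨u, rfl, hu, he⟩ := G.exists_walk K v
  refine (h.output_le_walk G u hu).trans ?_
  rw [he, mul_add, Finset.mul_sum]
  gcongr with s hs
  exact h1 s (Finset.mem_range.1 hs)

/-- At each step the neighbour attaining the network's minimum is one candidate in the Bellman-Ford
minimum, so the distance grows by at most its edge weight. -/
theorem BlockCoeffs.mul_dist_le_output {θ : Params m K d} {α γ : ℕ → ℝ} (h : BlockCoeffs θ α γ)
    {α' γ' : ℕ → ℝ}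
    (hα' : ∀ t, α' t = 2 * α t - gain θ (blockStart m K t) (blockStart m K (t + 1)))
    (hγ' : ∀ t, γ' t = 2 * γ t - nC θ t * gain θ (layerStart m t + 1) (blockStart m K (t + 1)))
    (hn : ∀ t ≤ K, 0 ≤ α' t)
    {p : ℝ} (h0 : p ≤ rem K α' 0) (h1 : ∀ t < K, p ≤ γ' t * rem K α' (t + 1))
    (G : BFInstance.{u}) (v : G.V) :
    p * G.dist K v - bias θ 0 (2 * m * K) ≤ output θ G v := by
  have hle : ∀ t ≤ K, α' t ≤ gain θ (blockStart m K t) (blockStart m K (t + 1)) := fun t ht => by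
    linarith [hα' t, h.le_gain t ht]
  have key : ∀ t ≤ K, ∀ v, p * G.dist t v - rem K α' t * bias θ 0 (blockStart m K t)
      ≤ rem K α' t * aggVal θ G t v := by
    intro t ht
    induction t with
    | zero =>
      intro v
      simp only [aggVal, blockStart, bias_self, mul_zero, sub_zero, BFInstance.dist]
      exact mul_le_mul_of_nonneg_right h0 (NNReal.coe_nonneg _)
    | succ t ih =>
      intro v
      obtain ⟨u, hu, hlow⟩ := h.exists_le_aggVal_succ G ht v
      rw [← hα', ← hγ'] at hlow
      have h2 := ih (Nat.le_of_succ_le ht) u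
      have h3 := mul_le_mul_of_nonneg_left hlow (rem_nonneg hn (t + 1))
      have h4 := mul_le_mul_of_nonneg_left (mul_bias_add_bias_le θ (Nat.zero_le _)
        (blockStart_le_succ (m := m) (Nat.le_of_succ_le ht)) (hle t (Nat.le_of_succ_le ht)))
        (rem_nonneg hn (t + 1))
      have h5 := mul_le_mul_of_nonneg_right (h1 t ht) (NNReal.coe_nonneg (G.weight v u))
      rw [rem_eq_mul (Nat.le_of_succ_le ht)] at h2
      -- For `p ≤ 0` the left side is nonpositive and the right side nonnegative.
      rcases le_total 0 p with hp | hp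
      · have h6 : (G.dist (t + 1) v : ℝ) ≤ G.dist t u + G.weight v u := by
          rw [G.weight_comm]; exact_mod_cast G.dist_succ_le t hu
        have h7 := mul_le_mul_of_nonneg_left h6 hp
        linarith
      · have h6 := mul_nonneg (rem_nonneg hn (t + 1)) (h.aggVal_nonneg G (t + 1) ht v)
        have h7 := mul_nonneg (rem_nonneg hn (t + 1))
          (bias_nonneg θ 0 (blockStart m K (t + 1)))
        have h8 := mul_nonneg (neg_nonneg.2 hp) (NNReal.coe_nonneg (G.dist (t + 1) v))
        linarith
  have h1 := key K le_rfl v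
  have h2 := (h.last _ (h.aggVal_nonneg G K le_rfl v)
    ⟨0, by rw [dim_layerStart_last]; exact one_pos⟩).2.1
  have h3 := mul_bias_add_bias_le θ (Nat.zero_le _) (blockStart_le_succ (m := m) le_rfl)
    (hle K le_rfl)
  rw [rem_eq_mul le_rfl, rem_last, mul_one] at h1
  rw [output_eq_pre]
  rw [← hα'] at h2
  rw [blockStart_last] at h2 h3
  linarith

/-! ### The path training set -/

/-- The coefficient of the `k`-th entry of `z` in the bound for the output at the path `P_β(z)`. -/
noncomputable def pathCoeff (K : ℕ) (α γ : ℕ → ℝ) : ℕ → ℝ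
  | 0 => rem K α 0
  | t + 1 => γ t * rem K α (t + 1)

theorem weight_pathInstance (β : ℝ≥0) (z : Fin (K + 1) → ℝ≥0) {i j : Fin (K + 1)}
    (h : i.val + 1 = j.val) : (pathInstance K β z).weight j i = z j := by
  have hadj : (SimpleGraph.pathGraph (K + 1)).Adj j i :=
    SimpleGraph.pathGraph_adj.2 (Or.inr h)
  have hle : i ≤ j := Fin.le_def.2 (by omega)
  have hsup : (s(j, i) : Sym2 (Fin (K + 1))).sup = j := by
    rw [Sym2.sup_mk, sup_eq_left.2 hle]
  unfold BFInstance.weight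
  refine (dif_pos hadj).trans ?_
  change z (s(j, i) : Sym2 (Fin (K + 1))).sup = z j
  rw [hsup]

theorem mem_nbrs_pathInstance (β : ℝ≥0) (z : Fin (K + 1) → ℝ≥0) {i j : Fin (K + 1)} :
    i ∈ (pathInstance K β z).nbrs j ↔ i = j ∨ j.val + 1 = i.val ∨ i.val + 1 = j.val := by
  exact (BFInstance.mem_nbrs _).trans (or_congr_right SimpleGraph.pathGraph_adj)

/-- Along the straight walk `v_0, …, v_K` the only nonzero entry of `x e_k` selects a single
coefficient. -/
theorem BlockCoeffs.output_path_le {θ : Params m K d} {α γ : ℕ → ℝ} (h : BlockCoeffs θ α γ)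
    (β x : ℝ≥0) (k : Fin (K + 1)) :
    output θ (pathInstance K β (Pi.single k x)) (Fin.last K)
      ≤ pathCoeff K α γ k * x + bias θ 0 (2 * m * K) := by
  let u : ℕ → Fin (K + 1) := fun t => ⟨min t K, by omega⟩
  have hs : ∀ t < K, (u t).val + 1 = (u (t + 1)).val := fun t ht => by
    simp only [u]; omega
  have hK : u K = Fin.last K := by simp [u, Fin.last]
  have h1 := h.output_le_walk (pathInstance K β (Pi.single k x)) u
    fun t ht => (mem_nbrs_pathInstance β _).2 (Or.inr (Or.inr (hs t ht)))
  rw [← hK]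
  refine h1.trans (add_le_add_left (le_of_eq ?_) _)
  have hlabel : ((pathInstance K β (Pi.single k x)).label (u 0) : ℝ)
      = if 0 = k.val then (x : ℝ) else 0 := by
    have : (pathInstance K β (Pi.single k x)).label (u 0)
        = (Pi.single k x : Fin (K + 1) → ℝ≥0) 0 := by
      change (if u 0 = 0 then _ else β) = _
      exact if_pos (Fin.ext (Nat.zero_min K))
    rw [this, Pi.single_apply]
    simp only [Fin.ext_iff, Fin.val_zero]
    split_ifs <;> rfl
  have hw : ∀ s ∈ Finset.range K,
      γ s * rem K α (s + 1) * (pathInstance K β (Pi.single k x)).weight (u (s + 1)) (u s)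
      = if s + 1 = k.val then pathCoeff K α γ (s + 1) * (x : ℝ) else 0 := fun s hs' => by
    have hs' := Finset.mem_range.1 hs'
    rw [weight_pathInstance β _ (hs s hs'), Pi.single_apply, pathCoeff]
    have : (u (s + 1) = k) = (s + 1 = k.val) := by
      simp only [u, Fin.ext_iff, min_eq_left (show s + 1 ≤ K from hs')]
    simp only [this]
    split_ifs <;> simp
  rw [hlabel, Finset.sum_congr rfl hw]
  have hsum : ∑ s ∈ Finset.range (K + 1), (if s = k.val then pathCoeff K α γ s * (x : ℝ) else 0)
      = pathCoeff K α γ k * x := by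
    rw [Finset.sum_ite_eq', if_pos (Finset.mem_range.2 k.isLt)]
  rw [← hsum, Finset.sum_range_succ', add_comm, pathCoeff]
  simp only [mul_ite, mul_zero]

/-- A walk ending at or beyond `v_k` either starts there, with label at least `x`, or crosses the
edge of weight `x` into `v_k`. -/
theorem le_dist_path (β x : ℝ≥0) (hβ : x ≤ β) (k : Fin (K + 1)) (t : ℕ) (i : Fin (K + 1))
    (hi : k ≤ i) : x ≤ (pathInstance K β (Pi.single k x)).dist t i := by
  suffices h : ∀ i : Fin (K + 1),
      (if k ≤ i then x else 0) ≤ (pathInstance K β (Pi.single k x)).dist t i by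
    simpa [hi] using h i
  clear hi i
  induction t with
  | zero =>
    intro i
    rw [BFInstance.dist]
    change _ ≤ if i = 0 then (Pi.single k x : Fin (K + 1) → ℝ≥0) 0 else β
    by_cases hi : i = 0
    · subst hi
      rw [if_pos rfl, Pi.single_apply]
      simp only [Fin.le_zero_iff, eq_comm, le_refl]
    · rw [if_neg hi]
      split_ifs
      exacts [hβ, zero_le]
  | succ t ih =>
    intro i
    obtain ⟨j, hj, he⟩ := BFInstance.exists_dist_succ_eq t (pathInstance K β (Pi.single k x)) i
    rw [he]
    split_ifs with hi
    swap
    · exact zero_le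
    by_cases hkj : k ≤ j
    · exact (by simpa [hkj] using ih j : x ≤ _).trans le_self_add
    · have hkj' := Fin.lt_def.1 (not_le.1 hkj)
      have hi' := Fin.le_def.1 hi
      have hji : j.val + 1 = i.val := by
        -- As `j < k ≤ i` and `j`, `i` are equal or adjacent, `i = k` and `j` precedes it: this is
        -- the crossing.
        rcases (mem_nbrs_pathInstance β _).1 hj with h | h | h
        · rw [h] at hkj'; omega
        · omega
        · exact h
      have hik : i = k := Fin.ext (by omega)
      have hw : (pathInstance K β (Pi.single k x)).weight j i = x :=
        (BFInstance.weight_comm _ _ _).trans ((weight_pathInstance β _ hji).trans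
          (by rw [hik, Pi.single_eq_same]))
      exact le_add_of_nonneg_of_le zero_le hw.ge

/-- Makes the `K + 1` training pairs distinct for `x ≠ 0`, so their errors occur as separate terms
of the empirical loss and `K + 1 ≤ N`. -/
theorem pathInstance_injective (β : ℝ≥0) : Function.Injective (pathInstance K β) := by
  intro z z' h
  unfold pathInstance at h
  simp only [BFInstance.mk.injEq, heq_eq_eq, true_and] at h
  obtain ⟨h1, h2⟩ := h
  funext i
  by_cases hi : i = 0
  · subst hi
    simpa using congrFun h1 0
  · have hi' : i.val ≠ 0 := fun h => hi (Fin.ext h)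
    let j : Fin (K + 1) := ⟨i.val - 1, by omega⟩
    have hadj : (SimpleGraph.pathGraph (K + 1)).Adj i j :=
      SimpleGraph.pathGraph_adj.2 (Or.inr (by simp only [j]; omega))
    have hle : j ≤ i := Fin.le_def.2 (by simp only [j]; omega)
    have hsup : (s(i, j) : Sym2 (Fin (K + 1))).sup = i := by
      rw [Sym2.sup_mk, sup_eq_left.2 hle]
    have := congrFun h2 ⟨s(i, j), hadj⟩
    simpa only [hsup] using this

/-! ### The regularizer -/

/-- The norms of the parameter blocks that act on the `k`-th entry of `z` at the path `P_β(z)`,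
indexed by layers: the edge weight vector if `k ≥ 1`, followed by the weight matrices. -/
noncomputable def layerNorm (θ : Params m K d) : ℕ → ℕ → ℝ
  | 0, j => nW θ j
  | k + 1, j => if j = layerStart m k then nC θ k else nW θ j

theorem layerNorm_nonneg (θ : Params m K d) (k j : ℕ) : 0 ≤ layerNorm θ k j := by
  cases k with
  | zero => exact nW_nonneg _ _
  | succ k =>
    change 0 ≤ if j = layerStart m k then nC θ k else nW θ j
    split_ifs
    exacts [nC_nonneg _ _, nW_nonneg _ _]

/-- The layers that act on the `k`-th entry of `z` at the path `P_β(z)`. -/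
def activeLayers (m K : ℕ) (k : ℕ) : Finset ℕ := Finset.Ico (layerStart m (k - 1)) (2 * m * K)

theorem card_activeLayers_le (k : ℕ) : (activeLayers m K k).card ≤ 2 * m * K := by
  simp [activeLayers]

theorem sum_card_activeLayers :
    ∑ k ∈ Finset.range (K + 1), ((activeLayers m K k).card : ℝ) = m * ((K : ℝ) ^ 2 + 3 * K) := by
  -- Index `0` contributes `2mK` layers and index `k ≥ 1` contributes `2m(K - k + 1)`; `K` stays
  -- fixed while the range grows.
  have h : ∀ n ≤ K, ∑ k ∈ Finset.range (n + 1), ((activeLayers m K k).card : ℝ)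
      = 2 * m * K * (n + 1) - m * (n * (n - 1)) := by
    intro n hn
    induction n with
    | zero => simp [activeLayers, layerStart]
    | succ n ih =>
      have hle : 2 * m * n ≤ 2 * m * K := Nat.mul_le_mul_left _ (by omega)
      rw [Finset.sum_range_succ, ih (by omega), activeLayers, Nat.card_Ico, Nat.add_sub_cancel,
        layerStart_eq, Nat.cast_sub hle]
      push_cast
      ring
  rw [h K le_rfl]
  ring

theorem layerStart_lt (hm : 1 ≤ m) {t : ℕ} (ht : t < K) : layerStart m t < 2 * m * K := by
  have := layerStart_succ_le (m := m) ht
  omega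

theorem sum_layerNorm_succ (hm : 1 ≤ m) (θ : Params m K d) {t : ℕ} (ht : t < K) :
    ∑ j ∈ activeLayers m K (t + 1), layerNorm θ (t + 1) j
      = nC θ t + ∑ j ∈ Finset.Ico (layerStart m t + 1) (2 * m * K), nW θ j := by
  rw [activeLayers, Nat.add_sub_cancel, Finset.sum_eq_sum_Ico_succ_bot (layerStart_lt hm ht)]
  congr 1
  · simp [layerNorm]
  · refine Finset.sum_congr rfl fun j hj => if_neg ?_
    have := (Finset.mem_Ico.1 hj).1
    omega

theorem prod_layerNorm_succ (hm : 1 ≤ m) (θ : Params m K d) {t : ℕ} (ht : t < K) :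
    ∏ j ∈ activeLayers m K (t + 1), layerNorm θ (t + 1) j
      = nC θ t * gain θ (layerStart m t + 1) (2 * m * K) := by
  rw [activeLayers, Nat.add_sub_cancel, Finset.prod_eq_prod_Ico_succ_bot (layerStart_lt hm ht)]
  congr 1
  · simp [layerNorm]
  · refine Finset.prod_congr rfl fun j hj => if_neg ?_
    have := (Finset.mem_Ico.1 hj).1
    omega

theorem prod_layerNorm_zero (θ : Params m K d) :
    ∏ j ∈ activeLayers m K 0, layerNorm θ 0 j = gain θ 0 (2 * m * K) := rfl

/-- Regrouping by path entry: the `k`-th matrix sum starts just after the layer where the `k`-th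
edge vector enters, and that vector takes the vacated slot. -/
theorem regLoss_eq (hm : 1 ≤ m) (θ : Params m K d) :
    regLoss θ = ∑ k ∈ Finset.range (K + 1), ∑ j ∈ activeLayers m K k, layerNorm θ k j
      + ∑ j ∈ Finset.range (2 * m * K), nb θ j := by
  have hW : ∀ e : ℕ, ∑ j : Fin (2 * m * K) with e < j.val + 1, ∑ r, ∑ c, |θ.W j r c|
      = ∑ j ∈ Finset.Ico e (2 * m * K), nW θ j := by
    intro e
    have h1 : Finset.Ico e (2 * m * K) = (Finset.range (2 * m * K)).filter (e < · + 1) := by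
      ext j; simp only [Finset.mem_Ico, Finset.mem_filter, Finset.mem_range]; omega
    rw [h1, Finset.sum_filter, Finset.sum_filter, Finset.sum_range]
    refine Finset.sum_congr rfl fun j _ => ?_
    rw [nW, dif_pos j.isLt]
    rfl
  have hC : ∑ k, ∑ r, |θ.C k r| = ∑ k ∈ Finset.range K, nC θ k := by
    rw [Finset.sum_range]
    refine Finset.sum_congr rfl fun k _ => ?_
    rw [nC, dif_pos k.isLt]
    rfl
  have hb : ∑ j, ∑ r, |θ.b j r| = ∑ j ∈ Finset.range (2 * m * K), nb θ j := by
    rw [Finset.sum_range]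
    refine Finset.sum_congr rfl fun k _ => ?_
    rw [nb, dif_pos k.isLt]
    rfl
  rw [regLoss, hC, hb]
  congr 1
  rw [Finset.sum_range_succ', Finset.sum_range_succ']
  have : ∀ t ∈ Finset.range K, ∑ j ∈ activeLayers m K (t + 1), layerNorm θ (t + 1) j
      = nC θ t + ∑ j ∈ Finset.Ico (layerStart m t + 1) (2 * m * K), nW θ j :=
    fun t ht => sum_layerNorm_succ hm θ (Finset.mem_range.1 ht)
  rw [Finset.sum_congr rfl this, Finset.sum_add_distrib, hW,
    Finset.sum_congr rfl fun t _ => hW (edgeLayer m (t + 1))]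
  change _ + _ + _ = _ + _ + ∑ j ∈ Finset.Ico 0 (2 * m * K), nW θ j
  simp only [edgeLayer]
  ring

/-! ### Comparison of the path coefficients with the norms -/

theorem rem_gain (θ : Params m K d) {t : ℕ} (ht : t ≤ K + 1) :
    rem K (fun s => gain θ (blockStart m K s) (blockStart m K (s + 1))) t
      = gain θ (blockStart m K t) (2 * m * K) := by
  have h : ∀ n, t ≤ n → n ≤ K + 1 → blockStart m K t ≤ blockStart m K n ∧
      ∏ s ∈ Finset.Ico t n, gain θ (blockStart m K s) (blockStart m K (s + 1))
        = gain θ (blockStart m K t) (blockStart m K n) := by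
    intro n hn
    induction n, hn using Nat.le_induction with
    | base => simp
    | succ n hn ih =>
      intro hK
      obtain ⟨h1, h2⟩ := ih (by omega)
      have h3 := blockStart_le_succ (m := m) (show n ≤ K by omega)
      exact ⟨h1.trans h3, by rw [Finset.prod_Ico_succ_top hn, h2, gain_mul_gain θ h1 h3]⟩
  rw [rem, (h (K + 1) ht le_rfl).2, blockStart_last]

theorem mul_gain_mul_rem_gain (θ : Params m K d) (hm : 1 ≤ m) {t : ℕ} (ht : t < K) :
    nC θ t * gain θ (layerStart m t + 1) (blockStart m K (t + 1))
      * rem K (fun s => gain θ (blockStart m K s) (blockStart m K (s + 1))) (t + 1)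
      = nC θ t * gain θ (layerStart m t + 1) (2 * m * K) := by
  rw [rem_gain θ (by omega), mul_assoc, gain_mul_gain]
  · rw [blockStart_succ ht]; omega
  · exact min_le_right _ _

theorem BlockCoeffs.rem_le {θ : Params m K d} {α γ : ℕ → ℝ} (h : BlockCoeffs θ α γ) (t : ℕ) :
    rem K α t ≤ rem K (fun s => gain θ (blockStart m K s) (blockStart m K (s + 1))) t :=
  Finset.prod_le_prod (fun _ hs => h.nonneg _ (Nat.lt_succ_iff.1 (Finset.mem_Ico.1 hs).2))
    fun _ hs => h.le_gain _ (Nat.lt_succ_iff.1 (Finset.mem_Ico.1 hs).2)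

theorem BlockCoeffs.pathCoeff_le {θ : Params m K d} {α γ : ℕ → ℝ} (h : BlockCoeffs θ α γ)
    (hm : 1 ≤ m) {k : ℕ} (hk : k ≤ K) :
    pathCoeff K α γ k ≤ ∏ j ∈ activeLayers m K k, layerNorm θ k j := by
  cases k with
  | zero =>
    rw [prod_layerNorm_zero]
    exact (h.rem_le 0).trans_eq (rem_gain θ (Nat.zero_le _))
  | succ t =>
    rw [prod_layerNorm_succ hm θ hk, ← mul_gain_mul_rem_gain θ hm hk]
    exact mul_le_mul (h.le_gain_edge t hk) (h.rem_le _) (rem_nonneg h.nonneg _)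
      (mul_nonneg (nC_nonneg _ _) (gain_nonneg _ _ _))

/-- The condition at `k = 0` makes every block factor `2α - A` nonnegative; the product inequality
then converts twice a product minus a product into the product of lower coefficients. -/
theorem BlockCoeffs.mul_dist_le_output_of_pathCoeff {θ : Params m K d} {α γ : ℕ → ℝ}
    (h : BlockCoeffs θ α γ) (hm : 1 ≤ m) {p : ℝ} (hp : 0 < p)
    (hk : ∀ k ≤ K, p ≤ 2 * pathCoeff K α γ k - ∏ j ∈ activeLayers m K k, layerNorm θ k j)
    (G : BFInstance.{u}) (v : G.V) :
    p * G.dist K v - bias θ 0 (2 * m * K) ≤ output θ G v := by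
  have h0 : ∀ t, ∀ s ∈ Finset.Ico t (K + 1), 0 ≤ α s := fun t s hs =>
    h.nonneg s (Nat.lt_succ_iff.1 (Finset.mem_Ico.1 hs).2)
  have h1 : ∀ t, ∀ s ∈ Finset.Ico t (K + 1),
      α s ≤ gain θ (blockStart m K s) (blockStart m K (s + 1)) := fun t s hs =>
    h.le_gain s (Nat.lt_succ_iff.1 (Finset.mem_Ico.1 hs).2)
  have hz := hk 0 (Nat.zero_le K)
  rw [prod_layerNorm_zero, pathCoeff] at hz
  have hz' : gain θ 0 (2 * m * K)
      = rem K (fun s => gain θ (blockStart m K s) (blockStart m K (s + 1))) 0 :=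
    (rem_gain θ (Nat.zero_le _)).symm
  rw [hz'] at hz
  have hn : ∀ s ≤ K, 0 ≤ 2 * α s - gain θ (blockStart m K s) (blockStart m K (s + 1)) :=
    fun s hs => two_mul_sub_nonneg_of_prod _ _ _ (h0 0) (h1 0) (hp.trans_le hz) s
      (Finset.mem_Ico.2 ⟨Nat.zero_le s, Nat.lt_succ_of_le hs⟩)
  have hrem : ∀ t, 2 * rem K α t
      - rem K (fun s => gain θ (blockStart m K s) (blockStart m K (s + 1))) t
      ≤ rem K (fun s => 2 * α s - gain θ (blockStart m K s) (blockStart m K (s + 1))) t :=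
    fun t => two_mul_prod_sub_prod_le _ _ _ (h0 t) (h1 t) fun s hs =>
      hn s (Nat.lt_succ_iff.1 (Finset.mem_Ico.1 hs).2)
  refine h.mul_dist_le_output (fun _ => rfl) (fun _ => rfl) hn (hz.trans (hrem 0))
    (fun t ht => ?_) G v
  have hs := hk (t + 1) ht
  rw [prod_layerNorm_succ hm θ ht, ← mul_gain_mul_rem_gain θ hm ht, pathCoeff] at hs
  have hr := h.rem_le (t + 1)
  have hr0 := rem_nonneg h.nonneg (t + 1)
  have hr1 := hrem (t + 1)
  have hγ0 := h.nonneg_edge t ht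
  have hγ1 := h.le_gain_edge t ht
  refine hs.trans ?_
  set r := rem K α (t + 1)
  set R := rem K (fun s => gain θ (blockStart m K s) (blockStart m K (s + 1))) (t + 1)
  set Γ := nC θ t * gain θ (layerStart m t + 1) (blockStart m K (t + 1))
  -- Otherwise `2 γ r ≤ Γ r ≤ Γ R`, against the positive lower bound `p`. The rest is the two-factor
  -- case of `two_mul_prod_sub_prod_le`.
  have hpos : 0 ≤ 2 * γ t - Γ := by
    by_contra! hlt
    have e1 := mul_le_mul_of_nonneg_left hr (hγ0.trans hγ1)
    nlinarith
  have e1 := mul_le_mul_of_nonneg_left hr1 hpos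
  have e2 := mul_nonneg (sub_nonneg.2 hγ1) (sub_nonneg.2 hr)
  nlinarith

/-! ### Parameters that compute the Bellman-Ford distances -/

/-- The vector with first entry `y` and all other entries `0`. -/
def hot (n : ℕ) (y : ℝ) : Fin n → ℝ := fun i => if i.val = 0 then y else 0

theorem relu_hot {n : ℕ} {y : ℝ} (hy : 0 ≤ y) : relu (hot n y) = hot n y := by
  funext i
  unfold relu hot
  split_ifs
  exacts [max_eq_right hy, max_self 0]

theorem hot_add (n : ℕ) (y w : ℝ) : hot n y + hot n w = hot n (y + w) := by
  funext i
  simp only [hot, Pi.add_apply]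
  split_ifs <;> simp

theorem hot_zero (n : ℕ) : hot n 0 = 0 := by
  funext i
  simp [hot]

theorem smul_hot (n : ℕ) (w y : ℝ) : w • hot n y = hot n (w * y) := by
  funext i
  simp [hot]

theorem sum_hot {n : ℕ} (hn : 0 < n) (y : ℝ) : ∑ i, hot n y i = y := by
  rw [Finset.sum_eq_single (⟨0, hn⟩ : Fin n)]
  · simp [hot]
  · exact fun i _ hi => if_neg fun h => hi (Fin.ext h)
  · simp

theorem mulVec_hot {k n : ℕ} (hn : 0 < n) (y : ℝ) :
    Matrix.mulVec (fun r : Fin k => hot n (hot k 1 r)) (hot n y) = hot k y := by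
  funext r
  have : ∀ c, hot n (hot k 1 r) c * hot n y c = hot n (hot k y r) c := fun c => by
    unfold hot
    split_ifs <;> simp
  simp only [Matrix.mulVec, dotProduct, this, sum_hot hn]

theorem dim_pos (hd : 1 ≤ d) (j : ℕ) : 0 < dim m K d j := by
  unfold dim
  split_ifs
  exacts [one_pos, hd]

/-- Parameters for which the network performs the Bellman-Ford algorithm. -/
def exactParams (m K d : ℕ) : Params m K d where
  W _ := fun r => hot _ (hot _ 1 r)
  C _ := hot _ 1
  b _ := 0

theorem fnn_exactParams (hd : 1 ≤ d) (s : ℕ) {y w : ℝ} (hy : 0 ≤ y) (hw : 0 ≤ w) (n : ℕ)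
    (h : s + (n + 1) ≤ 2 * m * K) :
    fnn (exactParams m K d) s (hot _ w) (n + 1) h (hot _ y) = hot _ (y + w) := by
  induction n with
  | zero =>
    simp only [fnn, exactParams]
    rw [mulVec_hot (dim_pos hd s), hot_add, add_zero]
    exact relu_hot (add_nonneg hy hw)
  | succ n ih =>
    rw [fnn, ih]
    simp only [exactParams]
    rw [add_zero]
    exact (congrArg relu (mulVec_hot (dim_pos hd _) _)).trans (relu_hot (add_nonneg hy hw))

theorem hot_of_dim_one {n : ℕ} (hn : n = 1) (y : ℝ) : hot n y = fun _ => y := by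
  subst hn
  funext i
  exact if_pos (by omega)

theorem feature_exactParams (hm : 1 ≤ m) (hd : 1 ≤ d) (G : BFInstance.{u}) (t : ℕ) (ht : t ≤ K)
    (v : G.V) : feature (exactParams m K d) G t ht v = hot _ (G.dist t v : ℝ) := by
  obtain ⟨n, rfl⟩ : ∃ n, m = n + 1 := ⟨m - 1, by omega⟩
  induction t generalizing v with
  | zero => exact (hot_of_dim_one (if_pos (Or.inl rfl)) _).symm
  | succ t ih =>
    have hagg : ∀ u i, fnn (exactParams (n + 1) K d) (layerStart (n + 1) t)
        ((G.weight v u : ℝ) • (exactParams (n + 1) K d).C ⟨t, ht⟩) (n + 1)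
        ((Nat.le_add_right _ _).trans (layerStart_succ_le ht))
        (feature (exactParams (n + 1) K d) G t (Nat.le_of_succ_le ht) u) i
        = (G.dist t u : ℝ) + G.weight v u := by
      intro u i
      rw [ih (Nat.le_of_succ_le ht) u]
      have hC : (G.weight v u : ℝ) • (exactParams (n + 1) K d).C ⟨t, ht⟩
          = hot _ (G.weight v u : ℝ) := (smul_hot _ _ _).trans (by rw [mul_one])
      rw [hC, fnn_exactParams hd _ (NNReal.coe_nonneg _) (NNReal.coe_nonneg _),
        hot_of_dim_one (dim_aggregated ht)]
    have hmin : (G.nbrs v).inf' (G.nbrs_nonempty v)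
        (fun u => (G.dist t u : ℝ) + G.weight v u) = G.dist (t + 1) v := by
      apply le_antisymm
      · obtain ⟨u, hu, he⟩ := G.exists_dist_succ_eq t v
        rw [he, NNReal.coe_add, G.weight_comm u v]
        exact Finset.inf'_le (fun u => (G.dist t u : ℝ) + G.weight v u) hu
      · refine Finset.le_inf' _ _ fun u hu => ?_
        rw [G.weight_comm]
        exact_mod_cast G.dist_succ_le t hu
    rw [feature]
    simp only [hagg, hmin]
    rw [← hot_of_dim_one (dim_aggregated ht) (G.dist (t + 1) v : ℝ), ← hot_zero,
      fnn_exactParams hd _ (NNReal.coe_nonneg _) le_rfl, add_zero]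
    rfl

theorem output_exactParams (hm : 1 ≤ m) (hd : 1 ≤ d) (G : BFInstance.{u}) (v : G.V) :
    output (exactParams m K d) G v = G.dist K v := by
  rw [output, feature_exactParams hm hd]
  exact if_pos rfl

theorem abs_hot (n : ℕ) {y : ℝ} (hy : 0 ≤ y) (i : Fin n) : |hot n y i| = hot n y i := by
  unfold hot
  split_ifs
  exacts [abs_of_nonneg hy, abs_zero]

theorem vecNorm_hot {n : ℕ} (hn : 0 < n) : vecNorm (hot n 1) = 1 := by
  simp only [vecNorm, abs_hot n zero_le_one, sum_hot hn]

theorem matNorm_hot {k n : ℕ} (hk : 0 < k) (hn : 0 < n) :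
    matNorm (fun r : Fin k => hot n (hot k 1 r)) = 1 := by
  have h : ∀ r, 0 ≤ hot k 1 r := fun r => by unfold hot; split_ifs <;> norm_num
  unfold matNorm
  simp only [fun r => abs_hot n (h r), sum_hot hn, sum_hot hk]

theorem regLoss_exactParams (hm : 1 ≤ m) (hd : 1 ≤ d) :
    regLoss (exactParams m K d) = m * ((K : ℝ) ^ 2 + 3 * K) := by
  have hW : ∀ j < 2 * m * K, nW (exactParams m K d) j = 1 := fun j hj =>
    (dif_pos hj).trans (matNorm_hot (dim_pos hd _) (dim_pos hd _))
  have hC : ∀ k < K, nC (exactParams m K d) k = 1 := fun j hj =>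
    (dif_pos hj).trans (vecNorm_hot (dim_pos hd _))
  have hb : ∀ j ∈ Finset.range (2 * m * K), nb (exactParams m K d) j = 0 := fun j hj =>
    (dif_pos (Finset.mem_range.1 hj)).trans (by simp [exactParams, vecNorm])
  have hl : ∀ k ∈ Finset.range (K + 1), ∀ j ∈ activeLayers m K k,
      layerNorm (exactParams m K d) k j = 1 := by
    intro k hk j hj
    have hk := Finset.mem_range.1 hk
    have hj' := (Finset.mem_Ico.1 hj).2
    cases k with
    | zero => exact hW j hj'
    | succ k =>
      change (if j = layerStart m k then _ else _) = _
      split_ifs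
      exacts [hC k (by omega), hW j hj']
  rw [regLoss_eq hm, Finset.sum_congr rfl hb, Finset.sum_const_zero, add_zero,
    ← sum_card_activeLayers]
  refine Finset.sum_congr rfl fun k hk => ?_
  rw [Finset.sum_congr rfl (hl k hk)]
  simp

/-! ### Parameters of almost minimal loss -/

theorem pathTrainingPair_injective (β : ℝ≥0) {x : ℝ≥0} (hx : x ≠ 0) :
    Function.Injective fun k : Fin (K + 1) =>
      (⟨pathInstance K β (Pi.single k x), Fin.last K⟩ : VertexInstance.{0}) := by
  intro k k' h
  have h1 := pathInstance_injective β (congrArg Sigma.fst h)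
  by_contra hne
  have h2 := congrFun h1 k
  rw [Pi.single_eq_same, Pi.single_eq_of_ne hne] at h2
  exact hx h2

theorem empLoss_nonneg (X : Finset VertexInstance.{0}) (θ : Params m K d) : 0 ≤ empLoss X θ :=
  mul_nonneg (by positivity) (Finset.sum_nonneg fun _ _ => abs_nonneg _)

theorem sum_layerNorm_nonneg (θ : Params m K d) (k : ℕ) :
    0 ≤ ∑ j ∈ activeLayers m K k, layerNorm θ k j :=
  Finset.sum_nonneg fun _ _ => layerNorm_nonneg _ _ _

theorem regLoss_nonneg (hm : 1 ≤ m) (θ : Params m K d) : 0 ≤ regLoss θ := by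
  rw [regLoss_eq hm]
  exact add_nonneg (Finset.sum_nonneg fun _ _ => sum_layerNorm_nonneg _ _) (sum_nb_nonneg _ _)

theorem iInf_loss_bounds (hm : 1 ≤ m) (hd : 1 ≤ d) (X : Finset VertexInstance.{0}) {η : ℝ}
    (hη : 0 ≤ η) :
    (∀ θ : Params m K d, (⨅ θ' : Params m K d, loss X η θ') ≤ loss X η θ) ∧
    (⨅ θ' : Params m K d, loss X η θ') ≤ η * (m * ((K : ℝ) ^ 2 + 3 * K)) := by
  -- Needed because a real infimum over an unbounded family takes a default value.
  have hb : BddBelow (Set.range fun θ' : Params m K d => loss X η θ') := by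
    refine ⟨0, ?_⟩
    rintro _ ⟨θ', rfl⟩
    exact add_nonneg (empLoss_nonneg X θ') (mul_nonneg hη (regLoss_nonneg hm θ'))
  refine ⟨fun θ => ciInf_le hb θ, (ciInf_le hb (exactParams m K d)).trans_eq ?_⟩
  have : empLoss X (exactParams m K d) = 0 := by
    simp [empLoss, output_exactParams hm hd]
  rw [loss, this, zero_add, regLoss_exactParams hm hd]

/-- On path `k` the target is at least `x` and the output at most `pathCoeff K α γ k * x` plus the
bias error; sum over the distinct training pairs. -/
theorem BlockCoeffs.mul_sum_le {θ : Params m K d} {α γ : ℕ → ℝ} (h : BlockCoeffs θ α γ)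
    (X : Finset VertexInstance.{0}) {x β : ℝ≥0} (hx : x ≠ 0) (hβ : x ≤ β)
    (hX : pathTrainingSet K β x ⊆ (X : Set VertexInstance.{0})) :
    (K : ℝ) + 1 ≤ X.card ∧
    x * ∑ k ∈ Finset.range (K + 1), max 0 (1 - pathCoeff K α γ k)
      ≤ X.card * empLoss X θ + (K + 1) * bias θ 0 (2 * m * K) := by
  have hsub : Finset.univ.map ⟨_, pathTrainingPair_injective (K := K) β hx⟩ ⊆ X := by
    intro q hq
    obtain ⟨k, -, rfl⟩ := Finset.mem_map.1 hq
    exact hX ⟨k, rfl⟩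
  have hcard : (K : ℝ) + 1 ≤ X.card := by
    have := Finset.card_le_card hsub
    rw [Finset.card_map, Finset.card_univ, Fintype.card_fin] at this
    exact_mod_cast this
  refine ⟨hcard, ?_⟩
  have hpos : (X.card : ℝ) ≠ 0 := by
    have : (0 : ℝ) ≤ K := Nat.cast_nonneg K
    linarith
  have hsum := Finset.sum_le_sum_of_subset_of_nonneg hsub
    (f := fun q : VertexInstance.{0} => |output θ q.1 q.2 - (q.1.dist K q.2 : ℝ)|)
    fun _ _ _ => abs_nonneg _
  rw [Finset.sum_map] at hsum
  have hE : (X.card : ℝ) * empLoss X θ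
      = ∑ q ∈ X, |output θ q.1 q.2 - (q.1.dist K q.2 : ℝ)| := by
    rw [empLoss]
    field_simp
  rw [hE]
  have hB := bias_nonneg θ 0 (2 * m * K)
  have hk : ∀ k : Fin (K + 1), x * max 0 (1 - pathCoeff K α γ k)
      ≤ |output θ (pathInstance K β (Pi.single k x)) (Fin.last K)
        - ((pathInstance K β (Pi.single k x)).dist K (Fin.last K) : ℝ)|
        + bias θ 0 (2 * m * K) := by
    intro k
    have h1 := h.output_path_le β x k
    have h2 : (x : ℝ) ≤ (pathInstance K β (Pi.single k x)).dist K (Fin.last K) := by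
      exact_mod_cast le_dist_path β x hβ k K (Fin.last K) (Fin.le_last k)
    have h3 := neg_abs_le (output θ (pathInstance K β (Pi.single k x)) (Fin.last K)
        - ((pathInstance K β (Pi.single k x)).dist K (Fin.last K) : ℝ))
    rw [mul_max_of_nonneg _ _ (NNReal.coe_nonneg x), mul_zero]
    refine max_le (add_nonneg (abs_nonneg _) hB) ?_
    linarith
  have hk' := Finset.sum_le_sum fun k (_ : k ∈ Finset.univ) => hk k
  rw [← Finset.mul_sum, Finset.sum_add_distrib, Finset.sum_const, Finset.card_univ,
    Fintype.card_fin, nsmul_eq_mul] at hk'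
  rw [Finset.sum_range]
  push_cast at hk'
  refine hk'.trans (add_le_add_left hsum _)

theorem bias_le_of_regLoss (hm : 1 ≤ m) (θ : Params m K d) {M η : ℝ} (hM : 4 ≤ M)
    (hη : 2 * Real.exp M ≤ η) (hR : regLoss θ ≤ M + 1) :
    bias θ 0 (2 * m * K) ≤ η / 8 * ∑ j ∈ Finset.range (2 * m * K), nb θ j := by
  have hb := sum_nb_nonneg θ (Finset.range (2 * m * K))
  have hW : ∑ j ∈ Finset.Ico 0 (2 * m * K), nW θ j ≤ M + 1 := by
    refine le_trans ?_ hR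
    rw [regLoss_eq hm]
    have := Finset.single_le_sum (f := fun k => ∑ j ∈ activeLayers m K k, layerNorm θ k j)
      (fun k _ => sum_layerNorm_nonneg θ k) (Finset.mem_range.2 (Nat.succ_pos K))
    exact le_add_of_le_of_nonneg this hb
  rw [bias]
  simp only [← Finset.range_eq_Ico] at hW ⊢
  refine mul_le_mul_of_nonneg_right ?_ hb
  refine (prod_max_one_le_exp _ _ fun _ _ => nW_nonneg _ _).trans ?_
  -- `(M + 1)/2 ≤ M - 3/2` is exactly `M ≥ 4`. As `exp (3/2) ≥ 4`, the result is at most `exp M / 4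
  -- ≤ η / 8`.
  have h1 : Real.exp ((∑ j ∈ Finset.range (2 * m * K), nW θ j) / 2) ≤ Real.exp (M - (1 + 1 / 2)) :=
    Real.exp_le_exp.2 (by linarith)
  refine h1.trans ?_
  rw [Real.exp_sub, Real.exp_add, div_le_iff₀ (by positivity)]
  have h2 := Real.exp_one_gt_d9
  have h3 := Real.add_one_le_exp (1 / 2 : ℝ)
  have h4 : 4 ≤ Real.exp 1 * Real.exp (1 / 2) := by nlinarith
  have h5 := Real.exp_pos M
  nlinarith

/-- The estimates that follow from an almost minimal loss: `c k` and `S k` are the number and the sum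
of the norms on the `k`-th path, `P k` is their product, and `p k ≤ P k` is the coefficient that the
empirical loss `E` forces to be close to `1`. -/
theorem coeff_bounds {c S P p : ℕ → ℝ} {q M N E B b x η ε : ℝ} (hq : 1 ≤ q) (hη : 100 ≤ η)
    (hε0 : 0 ≤ ε) (hε : ε ≤ 1 / 2) (hE : 0 ≤ E) (hB0 : 0 ≤ B) (hb : 0 ≤ b)
    (hloss : E + η * (∑ k ∈ Finset.range (K + 1), S k + b) ≤ η * M + ε)
    (hM : ∑ k ∈ Finset.range (K + 1), c k = M) (hN : (K : ℝ) + 1 ≤ N)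
    (hx : 4 * q * N * η ≤ x)
    (hsum : x * ∑ k ∈ Finset.range (K + 1), max 0 (1 - p k) ≤ N * E + (K + 1) * B)
    (hB : B ≤ η / 8 * b) (hS : ∀ k ≤ K, c k - S k ≤ 2 * q * max 0 (1 - p k))
    (hP : ∀ k ≤ K, P k ≤ Real.exp (S k - c k)) (hpP : ∀ k ≤ K, p k ≤ P k) :
    B ≤ ε / 7 ∧ ∀ k ≤ K, p k ≤ 1 + ε / 50 ∧ 1 - ε / 10 ≤ 2 * p k - P k := by
  have hN0 : 0 < N := by
    have : (0 : ℝ) ≤ K := Nat.cast_nonneg K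
    linarith
  have hη0 : 0 < η := by linarith
  set Δ := ∑ k ∈ Finset.range (K + 1), max 0 (1 - p k) with hΔ
  have hΔ0 : 0 ≤ Δ := Finset.sum_nonneg fun _ _ => le_max_left _ _
  have hΔE : 4 * q * η * Δ ≤ E + B := by
    refine le_of_mul_le_mul_left ?_ hN0
    have h1 := mul_le_mul_of_nonneg_right hx hΔ0
    have h2 := mul_le_mul_of_nonneg_right hN hB0
    linarith
  have hdiff : ∀ s ⊆ Finset.range (K + 1), ∑ k ∈ s, (c k - S k) ≤ 2 * q * Δ := by
    intro s hs
    have h1 : ∑ k ∈ s, (c k - S k) ≤ ∑ k ∈ s, 2 * q * max 0 (1 - p k) :=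
      Finset.sum_le_sum fun k hk => hS k (Nat.lt_succ_iff.1 (Finset.mem_range.1 (hs hk)))
    have h2 : ∑ k ∈ s, max 0 (1 - p k) ≤ Δ :=
      Finset.sum_le_sum_of_subset_of_nonneg hs fun _ _ _ => le_max_left _ _
    rw [← Finset.mul_sum] at h1
    exact h1.trans (mul_le_mul_of_nonneg_left h2 (by linarith))
  have htot := hdiff _ subset_rfl
  rw [Finset.sum_sub_distrib, hM] at htot
  have htot' := mul_le_mul_of_nonneg_left htot hη0.le
  -- The regularizer saves `η (M - ∑ S) ≤ 2qηΔ ≤ (E + B)/2`, which absorbs only half of `E` and, by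
  -- `B ≤ ηb/8`, a sixteenth of `ηb`.
  have hmain : E / 2 + 15 / 16 * (η * b) ≤ ε := by linarith
  have hηb : 0 ≤ η * b := mul_nonneg hη0.le hb
  have hΔε : Δ ≤ ε / 100 := by
    have h1 : 400 * Δ ≤ 4 * q * η * Δ :=
      mul_le_mul_of_nonneg_right (by nlinarith) hΔ0
    linarith
  refine ⟨by linarith, fun k hk => ?_⟩
  have hmem : k ∈ Finset.range (K + 1) := Finset.mem_range.2 (Nat.lt_succ_of_le hk)
  have hrest := hdiff _ (Finset.erase_subset k _)
  have hsplit := Finset.add_sum_erase _ (fun k => c k - S k) hmem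
  rw [Finset.sum_sub_distrib (s := Finset.range (K + 1)), hM] at hsplit
  have hrest' := mul_le_mul_of_nonneg_left hrest hη0.le
  have hsplit' := congrArg (η * ·) hsplit
  simp only [mul_add, mul_sub] at hsplit'
  -- A single `S k` exceeds `c k` by at most the total excess plus what the other indices save, and
  -- that saving is again at most `2qΔ`.
  have hk1 : S k - c k ≤ ε / η := by
    rw [le_div_iff₀ hη0]
    linarith
  have hεη : ε / η ≤ ε / 100 := div_le_div_of_nonneg_left hε0 (by norm_num) hη
  have hεη0 : 0 ≤ ε / η := by positivity
  have hexp := Real.abs_exp_sub_one_le (x := ε / η) (by rw [abs_of_nonneg hεη0]; linarith)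
  rw [abs_of_nonneg hεη0] at hexp
  have hPk : P k ≤ 1 + ε / 50 := by
    have h1 := (hP k hk).trans (Real.exp_le_exp.2 hk1)
    linarith [le_abs_self (Real.exp (ε / η) - 1)]
  have hpk : 1 - p k ≤ Δ := (le_max_right 0 _).trans
    (Finset.single_le_sum (f := fun k => max 0 (1 - p k)) (fun _ _ => le_max_left _ _) hmem)
  exact ⟨(hpP k hk).trans hPk, by linarith⟩

end BFLearning

/-! ### Conclusion -/

theorem mainTheorem1 (K m d : ℕ) (hK : 1 ≤ K) (hm : 1 ≤ m) (hd : 1 ≤ d)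
    (X : Finset BFLearning.VertexInstance.{0}) (η : ℝ) (x β : ℝ≥0)
    (hη : 2 * (K : ℝ) * Real.exp ((m : ℝ) * ((K : ℝ) ^ 2 + 3 * (K : ℝ))) ≤ η)
    (hx : 4 * (m : ℝ) * (K : ℝ) * (X.card : ℝ) * η ≤ (x : ℝ))
    (hβ : 2 * ((X.card : ℝ) + (x : ℝ) + 1) ≤ (β : ℝ))
    (hX : BFLearning.pathTrainingSet K β x ⊆ (X : Set BFLearning.VertexInstance.{0}))
    (ε : ℝ) (hε : ε ≤ 1 / 2)
    (θ : BFLearning.Params m K d)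
    (hθ : BFLearning.loss X η θ ≤ (⨅ θ' : BFLearning.Params m K d, BFLearning.loss X η θ') + ε)
    (G : BFLearning.BFInstance.{u}) (v : G.V) :
    |BFLearning.output θ G v - (G.dist K v : ℝ)| ≤ ε * ((G.dist K v : ℝ) + 1) := by
  open BFLearning in
  have hK' : (1 : ℝ) ≤ K := by exact_mod_cast hK
  have hm' : (1 : ℝ) ≤ m := by exact_mod_cast hm
  have hmK : (1 : ℝ) ≤ m * K := one_le_mul_of_one_le_of_one_le hm' hK'
  obtain ⟨M, hMdef⟩ : ∃ M : ℝ, M = m * ((K : ℝ) ^ 2 + 3 * K) := ⟨_, rfl⟩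
  have hM : 4 ≤ M := by rw [hMdef]; nlinarith
  rw [← hMdef] at hη
  have hη2 : 2 * Real.exp M ≤ η := by nlinarith [Real.exp_pos M]
  have hη100 : 100 ≤ η := by
    have h1 : Real.exp 4 ≤ Real.exp M := Real.exp_le_exp.2 hM
    have h2 : Real.exp 4 = Real.exp 1 ^ 4 := by rw [← Real.exp_nat_mul]; norm_num
    have h3 : (2.7 : ℝ) ^ 4 ≤ Real.exp 1 ^ 4 :=
      pow_le_pow_left₀ (by norm_num) (by linarith [Real.exp_one_gt_d9]) 4
    norm_num at h3
    linarith
  have hη0 : 0 < η := by linarith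
  obtain ⟨hinf, hexact⟩ := iInf_loss_bounds (K := K) hm hd X hη0.le
  -- The loss of `θ` is at least the infimum, so the hypothesis on `θ` forces the sign of `ε`.
  have hε0 : 0 ≤ ε := by linarith [hinf θ]
  have hloss := hθ.trans (add_le_add_left hexact ε)
  rw [← hMdef, loss] at hloss
  have hcard : (0 : ℝ) < X.card := by
    exact_mod_cast Finset.card_pos.2 ⟨_, hX ⟨0, rfl⟩⟩
  have hx0 : x ≠ 0 := by
    rintro rfl
    have : 0 < 4 * (m : ℝ) * K * X.card * η := by positivity
    rw [NNReal.coe_zero] at hx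
    linarith
  have hβx : x ≤ β := by
    rw [← NNReal.coe_le_coe]
    linarith [NNReal.coe_nonneg x]
  obtain ⟨α, γ, h⟩ := exists_blockCoeffs hm θ
  obtain ⟨hN, hsum⟩ := h.mul_sum_le X hx0 hβx hX
  have hE := empLoss_nonneg X θ
  have hR : regLoss θ ≤ M + 1 := by
    have := regLoss_nonneg hm θ
    nlinarith
  have hB := bias_le_of_regLoss hm θ hM hη2 hR
  have hB0 := bias_nonneg θ 0 (2 * m * K)
  have hb0 := sum_nb_nonneg θ (Finset.range (2 * m * K))
  have hS : ∀ k ≤ K, ((activeLayers m K k).card : ℝ)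
      - ∑ j ∈ activeLayers m K k, layerNorm θ k j
      ≤ 2 * m * K * max 0 (1 - pathCoeff K α γ k) := fun k hk =>
    (card_sub_sum_le _ _ (fun j _ => layerNorm_nonneg θ k j) _ (h.pathCoeff_le hm hk)).trans
      (mul_le_mul_of_nonneg_right (by exact_mod_cast card_activeLayers_le k) (le_max_left _ _))
  have hM' := sum_card_activeLayers (m := m) (K := K)
  rw [← hMdef] at hM'
  rw [regLoss_eq hm] at hloss
  have hP : ∀ k ≤ K, ∏ j ∈ activeLayers m K k, layerNorm θ k j
      ≤ Real.exp (∑ j ∈ activeLayers m K k, layerNorm θ k j - (activeLayers m K k).card) :=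
    fun k _ => prod_le_exp_sum_sub_card _ _ fun j _ => layerNorm_nonneg θ k j
  have hx' : 4 * (m * K : ℝ) * X.card * η ≤ x := by linarith
  obtain ⟨hBε, hk⟩ := coeff_bounds hmK hη100 hε0 hε hE hB0 hb0 hloss hM' hN hx' hsum hB
    (fun k hk => (hS k hk).trans_eq (by ring)) hP fun k hk => h.pathCoeff_le hm hk
  have hup := h.output_le_mul_dist (hk 0 (Nat.zero_le K)).1 (fun t ht => (hk (t + 1) ht).1) G v
  have hlow := h.mul_dist_le_output_of_pathCoeff hm (by linarith) (fun k hkK => (hk k hkK).2) G v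
  have hdist : 0 ≤ ε * (G.dist K v : ℝ) := mul_nonneg hε0 (NNReal.coe_nonneg _)
  -- The output lies between `(1 - ε/10) * dist - ε/7` and `(1 + ε/50) * dist + ε/7`.
  rw [abs_le]
  constructor <;> linarith
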